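/- Notation. Let $T>0$ and write $L^r(B)$ for $L^r((0,T);B(\mathbb{R}^d))$. Let $c:[0,\infty)\to[0,\infty)$ be strictly concave and Lipschitz with $c(0)=0$. For nonnegative densities $\mu,\nu\in L^1(\mathbb{R}^d)$ of equal total mass let $\Pi(\mu,\nu)$ be the set of measures on $\mathbb{R}^d\times\mathbb{R}^d$ with marginals $\mu\,dx$ and $\nu\,dx$, and $$\mathcal{D}_c(\mu,\nu)=\inf_{\pi\in\Pi(\mu,\nu)}\iint c(|x-y|)\,d\pi(x,y)\in[0,\infty].$$ For signed $\mu,\nu\in L^1(\mathbb{R}^d)$ of equal total mass the same definition is used with $\Pi(\mu,\nu):=\Pi(\mu^++\nu^-,\nu^++\mu^-)$; if the total masses differ, $\mathcal{D}_c(\mu,\nu)=\infty$. A Kantorovich potential for $\mathcal{D}_c(\mu,\nu)$ is a function $\zeta:\mathbb{R}^d\to\mathbb{R}$ with $|\zeta(x)-\zeta(y)|\le c(|x-y|)$ for all $x,y$ and $\zeta(x)-\zeta(y)=c(|x-y|)$ for $\pi$-almost all $(x,y)$, for some optimal plan $\pi\in\Pi(\mu,\nu)$. For $\kappa>0$, a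 function $\theta$ is a distributional solution of $\partial_t\theta+\nabla\cdot(u\theta)=\kappa\Delta\theta$ with initial datum $\theta^0$ if, for some $p,q$ with $\frac1p+\frac1q\le1$, one has $u\in L^1(L^p_{loc})$, $\theta^0\in L^q_{loc}(\mathbb{R}^d)$, $\theta\in L^\infty(L^q_{loc})$ and $$\iint_{(0,T)\times\mathbb{R}^d}\theta\,(\partial_t\phi+u\cdot\nabla\phi+\kappa\Delta\phi)\,dx\,dt+\int_{\mathbb{R}^d}\theta^0\,\phi|_{t=0}\,dx=0\qquad\text{for all }\phi\in C_c^\infty([0,T)\times\mathbb{R}^d).$$ Lemma. For $i=1,2$ let $\kappa_i>0$ and let $\mu_i\in L^1(W^{1,1})$ be a distributional solution of $\partial_t\mu_i+\nabla\cdot(u_i\mu_i)=\kappa_i\Delta\mu_i$ with initial datum $\mu_i^0$, such that $u_i\mu_i\in L^1(L^1)$. Assume that either $\mu_1^0,\mu_2^0\in L^1(\mathbb{R}^d)$ and $\mathcal{D}_c(\mu_1^0,\mu_2^0)<\infty$, or $\mathcal{D}_c(\mu_1(t,\cdot),\mu_2(t,\cdot))<\infty$ for all $t$ in some non-null subset of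 $(0,T)$ (in particular, the total masses agree at such a time). Then $\mathcal{D}_c(\mu_1(t,\cdot),\mu_2(t,\cdot))$ is finite for almost every $t\in(0,T)$, and $t\mapsto\mathcal{D}_c(\mu_1(t,\cdot),\mu_2(t,\cdot))$ is absolutely continuous, that is, it agrees almost everywhere in $(0,T)$ with an absolutely continuous function $D$ on $[0,T]$. If $\mu_1^0,\mu_2^0\in L^1(\mathbb{R}^d)$, then moreover $\mathcal{D}_c(\mu_1^0,\mu_2^0)$ is finite and equal to $D(0)$. For almost every $t\in(0,T)$ a Kantorovich potential for $\mathcal{D}_c(\mu_1(t,\cdot),\mu_2(t,\cdot))$ exists, and for every such potential $\zeta_t$ the integrals below converge absolutely and $$\frac{d}{dt}D(t)=\int_{\mathbb{R}^d}\nabla\zeta_t\cdot(u_1(t,x)\mu_1(t,x)-u_2(t,x)\mu_2(t,x))\,dx-\int_{\mathbb{R}^d}\nabla\zeta_t\cdot(\kappa_1\nabla\mu_1(t,x)-\kappa_2\nabla\mu_2(t,x))\,dx .$$ -/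

import Mathlib

open MeasureTheory Set Filter Topology
open scoped ENNReal NNReal ContDiff

/-- The Euclidean space `ℝᵈ`. -/
abbrev Rd (d : ℕ) := EuclideanSpace ℝ (Fin d)

/-- Lebesgue measure on `(0,T) × ℝᵈ`. -/
noncomputable def spaceTime (d : ℕ) (T : ℝ) : Measure (ℝ × Rd d) :=
  (volume.restrict (Ioo 0 T)).prod volume

/-! ### Distributional solutions of the advection-diffusion equation -/

/-- `f ∈ L¹((0,T); Lᵖ_loc(ℝᵈ))`. -/
def MemL1Lploc {d : ℕ} {F : Type*} [NormedAddCommGroup F]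
    (T : ℝ) (p : ℝ≥0∞) (f : ℝ → Rd d → F) : Prop :=
  AEStronglyMeasurable (Function.uncurry f) (spaceTime d T) ∧
    ∀ K : Set (Rd d), IsCompact K →
      ∫⁻ t in Ioo 0 T, eLpNorm (f t) p (volume.restrict K) < ⊤

/-- `f ∈ L^∞((0,T); L^q_loc(ℝᵈ))`. -/
def MemLinftyLqloc {d : ℕ} {F : Type*} [NormedAddCommGroup F]
    (T : ℝ) (q : ℝ≥0∞) (f : ℝ → Rd d → F) : Prop :=
  AEStronglyMeasurable (Function.uncurry f) (spaceTime d T) ∧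
    ∀ K : Set (Rd d), IsCompact K →
      ∃ C : ℝ≥0, ∀ᵐ t ∂(volume.restrict (Ioo 0 T)), eLpNorm (f t) q (volume.restrict K) ≤ C

/-- Elements of `C_c^∞([0,T) × ℝᵈ)`, as restrictions of smooth functions on `ℝ × ℝᵈ` whose
support is compact and contained in `(-∞,T) × ℝᵈ`. -/
def IsTestFunction {d : ℕ} (T : ℝ) (φ : ℝ × Rd d → ℝ) : Prop :=
  ContDiff ℝ ∞ φ ∧ HasCompactSupport φ ∧ tsupport φ ⊆ {z | z.1 < T}

/-- `θ` is a distributional solution on `(0,T) × ℝᵈ` of `∂ₜθ + ∇·(uθ) = κ Δθ` with initial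
datum `θ₀`. -/
def IsDistributionalSolution {d : ℕ} (T : ℝ) (u : ℝ → Rd d → Rd d) (κ : ℝ)
    (θ₀ : Rd d → ℝ) (θ : ℝ → Rd d → ℝ) : Prop :=
  (∃ p q : ℝ≥0∞, p⁻¹ + q⁻¹ ≤ 1 ∧ MemL1Lploc T p u ∧
      (∀ K : Set (Rd d), IsCompact K → MemLp θ₀ q (volume.restrict K)) ∧
      MemLinftyLqloc T q θ) ∧
    ∀ φ : ℝ × Rd d → ℝ, IsTestFunction T φ →
      ∫ z, θ z.1 z.2 *
          (deriv (fun s => φ (s, z.2)) z.1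
            + inner ℝ (u z.1 z.2) (gradient (fun y => φ (z.1, y)) z.2)
            + κ * Laplacian.laplacian (fun y => φ (z.1, y)) z.2) ∂(spaceTime d T)
        + ∫ x, θ₀ x * φ (0, x) = 0

/-- `g` is the weak gradient of `f` on `ℝᵈ`. -/
def HasWeakGradient {d : ℕ} (f : Rd d → ℝ) (g : Rd d → Rd d) : Prop :=
  ∀ φ : Rd d → ℝ, ContDiff ℝ ∞ φ → HasCompactSupport φ →
    ∫ x, f x • gradient φ x = -∫ x, φ x • g x

/-- `θ ∈ L¹((0,T); W^{1,1}(ℝᵈ))`, with spatial weak gradient `∇θ = g`. -/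
def MemL1W11 {d : ℕ} (T : ℝ) (θ : ℝ → Rd d → ℝ) (g : ℝ → Rd d → Rd d) : Prop :=
  Integrable (Function.uncurry θ) (spaceTime d T) ∧
    Integrable (Function.uncurry g) (spaceTime d T) ∧
    ∀ᵐ t ∂(volume.restrict (Ioo 0 T)), HasWeakGradient (θ t) (g t)

/-! ### Optimal transportation distances -/

/-- Cost functions `c : [0,∞) → [0,∞)`: strictly concave, Lipschitz, with `c 0 = 0`.
Only the values of `c` on `[0,∞)` matter. -/
structure IsConcaveCost (c : ℝ → ℝ) : Prop where
  zero : c 0 = 0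
  nonneg : ∀ z, 0 ≤ z → 0 ≤ c z
  strictConcave : StrictConcaveOn ℝ (Ici 0) c
  lipschitz : ∃ L : ℝ≥0, LipschitzOnWith L c (Ici 0)

/-- The transport plans `Π(m,n)` between two measures. -/
def transportPlans {d : ℕ} (m n : Measure (Rd d)) : Set (Measure (Rd d × Rd d)) :=
  {π | π.map Prod.fst = m ∧ π.map Prod.snd = n}

/-- The total cost `∬ c(|x-y|) dπ(x,y)`. -/
noncomputable def planCost {d : ℕ} (c : ℝ → ℝ) (π : Measure (Rd d × Rd d)) : ℝ≥0∞ :=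
  ∫⁻ z, ENNReal.ofReal (c (dist z.1 z.2)) ∂π

/-- The mass to be moved from `μ` to `ν`: the measure with density `μ⁺ + ν⁻`
(which is just `μ` if both densities are nonnegative). -/
noncomputable def sourceMeasure {d : ℕ} (μ ν : Rd d → ℝ) : Measure (Rd d) :=
  volume.withDensity fun x => ENNReal.ofReal (μ x) + ENNReal.ofReal (-ν x)

/-- The transport plans between two (possibly signed) densities: the couplings of `μ⁺ + ν⁻`
and `ν⁺ + μ⁻`. For nonnegative densities these are the couplings of `μ` and `ν`, and for
`ν = 0` those of `μ⁺` and `μ⁻`. -/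
def densityPlans {d : ℕ} (μ ν : Rd d → ℝ) : Set (Measure (Rd d × Rd d)) :=
  transportPlans (sourceMeasure μ ν) (sourceMeasure ν μ)

/-- The optimal transportation distance `𝒟_c(μ,ν)` (the Kantorovich problem). It is `∞` if
there are no plans, i.e. if integrable `μ`, `ν` have different total masses. -/
noncomputable def transportDist {d : ℕ} (c : ℝ → ℝ) (μ ν : Rd d → ℝ) : ℝ≥0∞ :=
  ⨅ π ∈ densityPlans μ ν, planCost c π

/-- `ζ` is a Kantorovich potential for `𝒟_c(μ,ν)`: it is admissible in the dual problem, and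
`ζ(x) - ζ(y) = c(|x-y|)` for almost all `(x,y)` with respect to an optimal plan. -/
def IsKantorovichPotential {d : ℕ} (c : ℝ → ℝ) (μ ν : Rd d → ℝ) (ζ : Rd d → ℝ) : Prop :=
  (∀ x y, |ζ x - ζ y| ≤ c (dist x y)) ∧
    ∃ π ∈ densityPlans μ ν, planCost c π = transportDist c μ ν ∧
      ∀ᵐ z ∂π, ζ z.1 - ζ z.2 = c (dist z.1 z.2)

/-! Since `c` is concave with `c 0 = 0`, the cost `c (dist x y)` is a pseudo-metric, so
Kantorovich–Rubinstein duality holds: the transport distance of `μ₁ t` and `μ₂ t` is the supremum of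
`∫ ζ (μ₁ t - μ₂ t)` over bounded `ζ` with `|ζ x - ζ y| ≤ c (dist x y)`. All such `ζ` share a
Lipschitz constant `L`, because `c z ≤ L z`.

For a fixed bounded Lipschitz `ζ`, the equations say that `∫ ζ (μ₁ - μ₂)` has time derivative `∫ ∇ζ
· V`, where `V` is the difference of the total fluxes `μᵢ uᵢ - κᵢ ∇μᵢ`, a function in `L¹(L¹)`. This
comes from `IsDistributionalSolution.ae_weakDiv`, where one null set of times serves all smooth test
functions, and from `WeakDivAgainst.of_bounded_lipschitz`, which admits bounded Lipschitz ones. The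
increments of all these functions are therefore bounded by those of a primitive of `L ∫ ‖V‖`, and
the supremum inherits the bound. So finiteness at one good time spreads to all good times, and the
distance is absolutely continuous (`EvolvesBy.transportDist_le`,
`EvolvesBy.exists_absolutelyContinuous`).

The derivative is an envelope argument. A potential `ζ` at time `t` attains the supremum at `t` and
is only a competitor at other times `s`. Hence `D s - ∫ r in t..s, ∫ ∇ζ · V r` is minimal at `s =
t`; where both terms are differentiable, their derivatives agree (`EvolvesBy.hasDerivAt`). As `ζ`
depends on `t`, the exceptional times must not depend on `ζ`: almost every `t` is a Lebesgue point
of `V` as an `L¹`-valued map, and this handles all Lipschitz `ζ` at once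
(`ae_hasDerivAt_integral_inner`).

Duality is proved by extending a positive functional (`exists_coupling_functional`) and representing
it by a measure (`exists_coupling_of_dual_le`). Potentials are limits of nearly optimal dual
functions (`exists_potential`). -/

open scoped BoundedContinuousFunction

/-! ### Kantorovich–Rubinstein duality for continuous pseudo-metric costs -/

/-- Continuous pseudo-metrics, seen as transport costs. -/
structure IsMetricCost {X : Type*} [TopologicalSpace X] (k : X → X → ℝ) : Prop where
  continuous : Continuous (Function.uncurry k)
  self : ∀ x, k x x = 0
  nonneg : ∀ x y, 0 ≤ k x y
  symm : ∀ x y, k x y = k y x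
  triangle : ∀ x y z, k x z ≤ k x y + k y z

/-- Functions that are `1`-Lipschitz with respect to the cost `k`. -/
def IsAdmissible {X : Type*} (k : X → X → ℝ) (ζ : X → ℝ) : Prop :=
  ∀ x y, |ζ x - ζ y| ≤ k x y

section Duality

variable {X : Type*}

lemma IsAdmissible.continuous [TopologicalSpace X] {k : X → X → ℝ} (hk : IsMetricCost k)
    {ζ : X → ℝ} (h : IsAdmissible k ζ) : Continuous ζ := by
  rw [continuous_iff_continuousAt]
  intro x
  have h1 : Tendsto (fun y => k y x) (𝓝 x) (𝓝 0) := by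
    have : Continuous fun y => k y x := hk.continuous.comp (by fun_prop : Continuous fun y => (y, x))
    simpa [hk.self] using this.tendsto x
  rw [ContinuousAt, tendsto_iff_norm_sub_tendsto_zero]
  exact squeeze_zero (fun _ => norm_nonneg _) (fun y => h y x) h1

/-- The `k`-transform `x ↦ inf_y (ψ y + k x y)`. -/
lemma exists_admissible_between [TopologicalSpace X] [Nonempty X] {k : X → X → ℝ}
    (hk : IsMetricCost k) (φ ψ : X →ᵇ ℝ) (h : ∀ x y, 0 ≤ φ x + ψ y + k x y) :
    ∃ ζ : X →ᵇ ℝ, IsAdmissible k ζ ∧ (∀ x, -φ x ≤ ζ x) ∧ ∀ x, ζ x ≤ ψ x := by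
  let z : X → ℝ := fun x => ⨅ y, (ψ y + k x y)
  have hb : ∀ x, BddBelow (range fun y => ψ y + k x y) := fun x =>
    ⟨-φ x, by rintro _ ⟨y, rfl⟩; have := h x y; simp only; linarith⟩
  have h1 : ∀ x, -φ x ≤ z x := fun x => le_ciInf fun y => by have := h x y; linarith
  have h2 : ∀ x, z x ≤ ψ x := fun x => by
    have := ciInf_le (hb x) x
    simpa [hk.self] using this
  have h3 : ∀ x x', z x - z x' ≤ k x x' := fun x x' => by
    have : z x - k x x' ≤ z x' := le_ciInf fun y => by
      have h4 := ciInf_le (hb x) y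
      have h5 := hk.triangle x x' y
      change z x ≤ _ at h4
      linarith
    linarith
  have h4 : IsAdmissible k z := fun x x' => abs_sub_le_iff.2
    ⟨h3 x x', by rw [hk.symm]; exact h3 x' x⟩
  refine ⟨BoundedContinuousFunction.ofNormedAddCommGroup z (h4.continuous hk) (‖φ‖ + ‖ψ‖)
    fun x => ?_, h4, h1, h2⟩
  have := φ.norm_coe_le_norm x
  have := ψ.norm_coe_le_norm x
  have := h1 x
  have := h2 x
  simp only [Real.norm_eq_abs, abs_le] at *
  constructor <;> linarith [norm_nonneg φ, norm_nonneg ψ]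

variable [MetricSpace X] [MeasurableSpace X] [BorelSpace X]

/-- After division by `a`, an admissible `ζ` fits between `-φ / a` and `ψ / a`; inserting it into
the dual bound gives the claim. This is the positivity needed for the Riesz extension. -/
lemma dual_nonneg_of_pos [Nonempty X] {k : X → X → ℝ} (hk : IsMetricCost k) {m n : Measure X}
    [IsFiniteMeasure m] [IsFiniteMeasure n] {S : ℝ}
    (hS : ∀ ζ : X →ᵇ ℝ, IsAdmissible k ζ → ∫ x, ζ x ∂m - ∫ x, ζ x ∂n ≤ S)
    (φ ψ : X →ᵇ ℝ) {a : ℝ} (ha : 0 < a) (h : ∀ x y, 0 ≤ φ x + ψ y + a * k x y) :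
    0 ≤ ∫ x, φ x ∂m + ∫ x, ψ x ∂n + a * S := by
  obtain ⟨ζ, hζ, h1, h2⟩ := exists_admissible_between hk (a⁻¹ • φ) (a⁻¹ • ψ) (fun x y => by
    have := mul_nonneg (inv_nonneg.2 ha.le) (h x y)
    simp only [BoundedContinuousFunction.coe_smul, smul_eq_mul]
    have h3 : a⁻¹ * (φ x + ψ y + a * k x y) = a⁻¹ * φ x + a⁻¹ * ψ y + k x y := by
      field_simp
    linarith)
  have h3 := hS ζ hζ
  have h4 : ∫ x, -(a⁻¹ • φ) x ∂m ≤ ∫ x, ζ x ∂m :=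
    integral_mono ((a⁻¹ • φ).integrable m).neg (ζ.integrable m) h1
  have h5 : ∫ x, ζ x ∂n ≤ ∫ x, (a⁻¹ • ψ) x ∂n :=
    integral_mono (ζ.integrable n) ((a⁻¹ • ψ).integrable n) h2
  simp only [BoundedContinuousFunction.coe_smul, smul_eq_mul, integral_neg,
    integral_const_mul] at h4 h5
  have h6 : 0 ≤ a⁻¹ * ∫ x, φ x ∂m + a⁻¹ * ∫ x, ψ x ∂n + S := by linarith
  have h7 := mul_nonneg ha.le h6
  have h8 : a * (a⁻¹ * ∫ x, φ x ∂m + a⁻¹ * ∫ x, ψ x ∂n + S)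
    = ∫ x, φ x ∂m + ∫ x, ψ x ∂n + a * S := by field_simp
  linarith

lemma dual_nonneg [Nonempty X] {k : X → X → ℝ} (hk : IsMetricCost k) {m n : Measure X}
    [IsFiniteMeasure m] [IsFiniteMeasure n] {S : ℝ}
    (hS : ∀ ζ : X →ᵇ ℝ, IsAdmissible k ζ → ∫ x, ζ x ∂m - ∫ x, ζ x ∂n ≤ S)
    (φ ψ : X →ᵇ ℝ) {a : ℝ} (ha : 0 ≤ a) (h : ∀ x y, 0 ≤ φ x + ψ y + a * k x y) :
    0 ≤ ∫ x, φ x ∂m + ∫ x, ψ x ∂n + a * S := by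
  -- The case `a = 0`, where one cannot divide, is reached by letting `b` decrease to `a`.
  have h1 : Tendsto (fun b => ∫ x, φ x ∂m + ∫ x, ψ x ∂n + b * S) (𝓝[>] a)
      (𝓝 (∫ x, φ x ∂m + ∫ x, ψ x ∂n + a * S)) :=
    (Continuous.tendsto (by fun_prop) a).mono_left nhdsWithin_le_nhds
  refine ge_of_tendsto h1 ?_
  filter_upwards [self_mem_nhdsWithin] with b hb
  refine dual_nonneg_of_pos hk hS φ ψ (ha.trans_lt hb) fun x y => (h x y).trans ?_
  have := mul_le_mul_of_nonneg_right (le_of_lt hb) (hk.nonneg x y)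
  linarith

/-- Data `(h, φ, ψ, a)`, to be thought of as `h + φ ⊕ ψ + a k` on `X × X`. -/
abbrev CouplingTest (X : Type*) [TopologicalSpace X] : Type _ :=
  (X × X →ᵇ ℝ) × (X →ᵇ ℝ) × (X →ᵇ ℝ) × ℝ

/-- A positive functional on bounded continuous functions that plays the role of a coupling. -/
lemma exists_coupling_functional [Nonempty X] {k : X → X → ℝ} (hk : IsMetricCost k)
    {m n : Measure X} [IsFiniteMeasure m] [IsFiniteMeasure n] {S : ℝ}
    (hS : ∀ ζ : X →ᵇ ℝ, IsAdmissible k ζ → ∫ x, ζ x ∂m - ∫ x, ζ x ∂n ≤ S) :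
    ∃ g : (X × X →ᵇ ℝ) →ₗ[ℝ] ℝ, (∀ h : X × X →ᵇ ℝ, (∀ z, 0 ≤ h z) → 0 ≤ g h) ∧
      (∀ (h : X × X →ᵇ ℝ) (φ ψ : X →ᵇ ℝ), (∀ z, h z = φ z.1 + ψ z.2) →
        g h = ∫ x, φ x ∂m + ∫ x, ψ x ∂n) ∧
      ∀ h : X × X →ᵇ ℝ, (∀ z, h z ≤ k z.1 z.2) → g h ≤ S := by
  -- The cost `k` may be unbounded, so it enters through the scalar coordinate `a` rather than as a
  -- bounded function. On the subspace `h = 0` the functional is prescribed: marginals `m` and `n`,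
  -- and value `S` on `k`.
  let s : PointedCone ℝ (CouplingTest X) :=
    { carrier := {w | 0 ≤ w.2.2.2 ∧
        ∀ z : X × X, 0 ≤ w.1 z + w.2.1 z.1 + w.2.2.1 z.2 + w.2.2.2 * k z.1 z.2}
      add_mem' := by
        rintro v w ⟨h1, h2⟩ ⟨h3, h4⟩
        refine ⟨add_nonneg h1 h3, fun z => ?_⟩
        have := add_nonneg (h2 z) (h4 z)
        simp only [Prod.fst_add, Prod.snd_add, BoundedContinuousFunction.coe_add, Pi.add_apply]
        linarith
      zero_mem' := by simp
      smul_mem' := by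
        rintro ⟨r, hr⟩ w ⟨h1, h2⟩
        refine ⟨mul_nonneg hr h1, fun z => ?_⟩
        have := mul_nonneg hr (h2 z)
        change 0 ≤ r * w.1 z + r * w.2.1 z.1 + r * w.2.2.1 z.2 + r * w.2.2.2 * k z.1 z.2
        linarith }
  let E : Submodule ℝ (CouplingTest X) := LinearMap.ker (LinearMap.fst ℝ (X × X →ᵇ ℝ) _)
  let F : CouplingTest X →ₗ[ℝ] ℝ :=
    { toFun := fun w => ∫ x, w.2.1 x ∂m + ∫ x, w.2.2.1 x ∂n + w.2.2.2 * S
      map_add' := fun v w => by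
        simp only [Prod.snd_add, Prod.fst_add, BoundedContinuousFunction.coe_add, Pi.add_apply]
        rw [integral_add (v.2.1.integrable m) (w.2.1.integrable m),
          integral_add (v.2.2.1.integrable n) (w.2.2.1.integrable n)]
        ring
      map_smul' := fun r w => by
        simp only [Prod.smul_snd, Prod.smul_fst, BoundedContinuousFunction.coe_smul, smul_eq_mul,
          integral_const_mul, RingHom.id_apply]
        ring }
  obtain ⟨G, hG1, hG2⟩ := riesz_extension s ⟨E, F.comp E.subtype⟩ (by
    rintro ⟨w, hw⟩ ⟨h1, h2⟩
    have hw' : w.1 = 0 := hw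
    exact dual_nonneg hk hS w.2.1 w.2.2.1 h1 fun x y => by simpa [hw'] using h2 (x, y)) (by
    intro y
    -- Every vector is moved into the cone by an element of the subspace: the constant compensates
    -- the three bounded functions, and `|a|` makes the coefficient of `k` nonnegative.
    refine ⟨⟨(0, BoundedContinuousFunction.const X (‖y.1‖ + ‖y.2.1‖ + ‖y.2.2.1‖), 0, |y.2.2.2|),
      rfl⟩, ?_, fun z => ?_⟩
    · change 0 ≤ |y.2.2.2| + y.2.2.2
      linarith [neg_abs_le y.2.2.2]
    · change 0 ≤ ((0 : ℝ) + y.1 z) + ((‖y.1‖ + ‖y.2.1‖ + ‖y.2.2.1‖) + y.2.1 z.1) + (0 + y.2.2.1 z.2)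
        + (|y.2.2.2| + y.2.2.2) * k z.1 z.2
      have h1 := neg_le_of_abs_le (y.1.norm_coe_le_norm z)
      have h2 := neg_le_of_abs_le (y.2.1.norm_coe_le_norm z.1)
      have h3 := neg_le_of_abs_le (y.2.2.1.norm_coe_le_norm z.2)
      have h4 : 0 ≤ (|y.2.2.2| + y.2.2.2) * k z.1 z.2 :=
        mul_nonneg (by linarith [neg_abs_le y.2.2.2]) (hk.nonneg _ _)
      linarith)
  have hGE : ∀ (φ ψ : X →ᵇ ℝ) (a : ℝ),
      G (0, φ, ψ, a) = ∫ x, φ x ∂m + ∫ x, ψ x ∂n + a * S := fun φ ψ a => hG1 ⟨(0, φ, ψ, a), rfl⟩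
  have hsplit : ∀ (h : X × X →ᵇ ℝ) (φ ψ : X →ᵇ ℝ) (a : ℝ),
      G (h, φ, ψ, a) = G (h, 0, 0, 0) + (∫ x, φ x ∂m + ∫ x, ψ x ∂n + a * S) := fun h φ ψ a => by
    rw [← hGE, ← map_add]; simp
  -- The three properties come from the cone elements `(h, 0, 0, 0)`, then `(h, -φ, -ψ, 0)` together
  -- with its negative, and `(-h, 0, 0, 1)`.
  refine ⟨G.comp (LinearMap.inl ℝ _ _), fun h hh => ?_, fun h φ ψ hh => ?_, fun h hh => ?_⟩
  · exact hG2 _ ⟨le_rfl, fun z => by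
      change 0 ≤ h z + 0 + 0 + 0 * k z.1 z.2
      simpa using hh z⟩
  · have h1 : 0 ≤ G (h, -φ, -ψ, 0) := hG2 _ ⟨le_rfl, fun z => by simp [hh z]⟩
    have h2 : 0 ≤ G (-h, φ, ψ, 0) := hG2 _ ⟨le_rfl, fun z => by simp [hh z]⟩
    have h3 : G (-h, 0, 0, 0) = -G (h, 0, 0, 0) := by rw [← map_neg]; simp
    rw [hsplit] at h1 h2
    rw [h3] at h2
    simp only [BoundedContinuousFunction.coe_neg, Pi.neg_apply, integral_neg] at h1
    change G (h, 0, 0, 0) = _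
    linarith
  · have h2 : 0 ≤ G (-h, 0, 0, 1) := hG2 _ ⟨zero_le_one, fun z => by simpa using hh z⟩
    have h3 : G (-h, 0, 0, 0) = -G (h, 0, 0, 0) := by rw [← map_neg]; simp
    rw [hsplit, h3] at h2
    simp only [BoundedContinuousFunction.coe_zero, Pi.zero_apply, integral_zero] at h2
    change G (h, 0, 0, 0) ≤ _
    linarith

end Duality

/-! ### Riesz–Markov representation of tight functionals -/

section Representation

open scoped CompactlySupported

/-- A continuous function that vanishes on the ball of radius `j` around `z₀` and equals `1` off
the ball of radius `j + 1`. -/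
noncomputable def farCutoff {Z : Type*} [MetricSpace Z] (z₀ : Z) (j : ℕ) : Z →ᵇ ℝ :=
  BoundedContinuousFunction.ofNormedAddCommGroup (fun z => max 0 (min 1 (dist z z₀ - j)))
    (by fun_prop) 1 fun z => by
      rw [Real.norm_eq_abs, abs_of_nonneg (le_max_left _ _)]
      exact max_le zero_le_one (min_le_left _ _)

lemma farCutoff_apply {Z : Type*} [MetricSpace Z] (z₀ : Z) (j : ℕ) (z : Z) :
    farCutoff z₀ j z = max 0 (min 1 (dist z z₀ - j)) := rfl

lemma farCutoff_nonneg {Z : Type*} [MetricSpace Z] (z₀ : Z) (j : ℕ) (z : Z) :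
    0 ≤ farCutoff z₀ j z := le_max_left _ _

lemma farCutoff_le_one {Z : Type*} [MetricSpace Z] (z₀ : Z) (j : ℕ) (z : Z) :
    farCutoff z₀ j z ≤ 1 := max_le zero_le_one (min_le_left _ _)

lemma farCutoff_eq_zero {Z : Type*} [MetricSpace Z] {z₀ : Z} {j : ℕ} {z : Z}
    (h : dist z z₀ ≤ j) : farCutoff z₀ j z = 0 := by
  rw [farCutoff_apply, max_eq_left]
  exact (min_le_right _ _).trans (by linarith)

lemma farCutoff_eq_one {Z : Type*} [MetricSpace Z] {z₀ : Z} {j : ℕ} {z : Z}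
    (h : (j : ℝ) + 1 ≤ dist z z₀) : farCutoff z₀ j z = 1 := by
  rw [farCutoff_apply, min_eq_left (by linarith), max_eq_right zero_le_one]

lemma tendsto_farCutoff {Z : Type*} [MetricSpace Z] (z₀ z : Z) :
    Tendsto (fun j : ℕ => farCutoff z₀ j z) atTop (𝓝 0) := by
  obtain ⟨N, hN⟩ := exists_nat_ge (dist z z₀)
  refine tendsto_const_nhds.congr' ?_
  filter_upwards [eventually_ge_atTop N] with j hj
  exact (farCutoff_eq_zero (hN.trans (by exact_mod_cast hj))).symm

lemma tendsto_integral_farCutoff {Z : Type*} [MetricSpace Z] [MeasurableSpace Z] [BorelSpace Z]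
    (z₀ : Z) (m : Measure Z) [IsFiniteMeasure m] :
    Tendsto (fun j : ℕ => ∫ z, farCutoff z₀ j z ∂m) atTop (𝓝 0) := by
  have := tendsto_integral_of_dominated_convergence (μ := m) (F := fun j z => farCutoff z₀ j z)
    (f := fun _ => (0 : ℝ)) (fun _ => (1 : ℝ))
    (fun j => ((farCutoff z₀ j).integrable m).aestronglyMeasurable) (integrable_const _)
    (fun j => .of_forall fun z => by
      rw [Real.norm_eq_abs, abs_of_nonneg (farCutoff_nonneg _ _ _)]
      exact farCutoff_le_one _ _ _)
    (.of_forall fun z => tendsto_farCutoff z₀ z)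
  simpa using this

/-- A tight positive functional on bounded continuous functions is represented by a measure. -/
lemma exists_measure_of_tight_functional {Z : Type*} [MetricSpace Z] [ProperSpace Z]
    [MeasurableSpace Z] [BorelSpace Z] (g : (Z →ᵇ ℝ) →ₗ[ℝ] ℝ)
    (hg : ∀ h : Z →ᵇ ℝ, (∀ z, 0 ≤ h z) → 0 ≤ g h) (z₀ : Z)
    (ht : Tendsto (fun j : ℕ => g (farCutoff z₀ j)) atTop (𝓝 0)) :
    ∃ π : Measure Z, IsFiniteMeasure π ∧ ∀ h : Z →ᵇ ℝ, ∫ z, h z ∂π = g h := by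
  have hmono : ∀ h h' : Z →ᵇ ℝ, (∀ z, h z ≤ h' z) → g h ≤ g h' := fun h h' hh => by
    have := hg (h' - h) fun z => by simpa using hh z
    rw [map_sub] at this
    linarith
  let ι : C_c(Z, ℝ) → (Z →ᵇ ℝ) := fun f => BoundedContinuousFunction.ofNormedAddCommGroup f
    f.continuous (Classical.choose (f.hasCompactSupport.exists_bound_of_continuous f.continuous))
    (Classical.choose_spec (f.hasCompactSupport.exists_bound_of_continuous f.continuous))
  -- Riesz–Markov only sees `g` on compactly supported functions. Tightness then rules out a
  -- contribution from infinity, through `|g (h * farCutoff z₀ j)| ≤ ‖h‖ * g (farCutoff z₀ j)`.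
  let Λ : C_c(Z, ℝ) →ₚ[ℝ] ℝ :=
    { toFun := fun f => g (ι f)
      map_add' := fun f f' => by
        rw [← map_add]; congr 1
      map_smul' := fun r f => by
        rw [RingHom.id_apply, ← map_smul]; congr 1
      monotone' := fun f f' h => hmono _ _ h }
  let π := RealRMK.rieszMeasure Λ
  have hcut : ∀ (h : Z →ᵇ ℝ) (j : ℕ),
      ∫ z, h z * (1 - farCutoff z₀ j z) ∂π = g (h * (1 - farCutoff z₀ j)) := fun h j => by
    let f : C_c(Z, ℝ) :=
      { toFun := fun z => h z * (1 - farCutoff z₀ j z)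
        continuous_toFun := by fun_prop
        hasCompactSupport' := HasCompactSupport.intro (isCompact_closedBall z₀ (j + 1)) fun z hz => by
          rw [farCutoff_eq_one (not_le.1 hz).le]; simp }
    have := RealRMK.integral_rieszMeasure Λ f
    exact this.trans (congrArg g (by ext z; rfl))
  have hmass : π univ ≤ ENNReal.ofReal (g 1) := by
    have h1 : ∀ j : ℕ, π (Metric.closedBall z₀ j) ≤ ENNReal.ofReal (g 1) := fun j => by
      let f : C_c(Z, ℝ) :=
        { toFun := fun z => (1 - farCutoff z₀ j z)
          continuous_toFun := by fun_prop
          hasCompactSupport' := HasCompactSupport.intro (isCompact_closedBall z₀ (j + 1))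
            fun z hz => by rw [farCutoff_eq_one (not_le.1 hz).le]; simp }
      refine (RealRMK.rieszMeasure_le_of_eq_one Λ (f := f)
        (fun z => sub_nonneg.2 (farCutoff_le_one _ _ _)) (isCompact_closedBall z₀ j)
        (fun z hz => ?_)).trans (ENNReal.ofReal_le_ofReal (hmono _ _ fun z => ?_))
      · change 1 - farCutoff z₀ j z = 1
        rw [farCutoff_eq_zero hz, sub_zero]
      · change 1 - farCutoff z₀ j z ≤ 1
        linarith [farCutoff_nonneg z₀ j z]
    rw [← Metric.iUnion_closedBall_nat z₀, Monotone.measure_iUnion]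
    · exact iSup_le h1
    · exact fun i j hij => Metric.closedBall_subset_closedBall (by exact_mod_cast hij)
  have hfin : IsFiniteMeasure π := ⟨hmass.trans_lt ENNReal.ofReal_lt_top⟩
  refine ⟨π, hfin, fun h => ?_⟩
  have h1 : Tendsto (fun j : ℕ => ∫ z, h z * (1 - farCutoff z₀ j z) ∂π) atTop
      (𝓝 (∫ z, h z ∂π)) := by
    refine tendsto_integral_of_dominated_convergence (fun _ => ‖h‖)
      (fun j => (by fun_prop : Continuous fun z => h z * (1 - farCutoff z₀ j z)).aestronglyMeasurable)
      (integrable_const _) (fun j => .of_forall fun z => ?_) (.of_forall fun z => ?_)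
    · rw [norm_mul, Real.norm_eq_abs (1 - _), abs_of_nonneg (sub_nonneg.2 (farCutoff_le_one _ _ _))]
      exact mul_le_of_le_one_right (norm_nonneg _) (by linarith [farCutoff_nonneg z₀ j z])
        |>.trans (h.norm_coe_le_norm z)
    · simpa using (tendsto_farCutoff z₀ z).const_sub 1 |>.const_mul (h z)
  have h2 : Tendsto (fun j : ℕ => g (h * (1 - farCutoff z₀ j))) atTop (𝓝 (g h)) := by
    have h3 : ∀ j : ℕ, |g (h * farCutoff z₀ j)| ≤ ‖h‖ * g (farCutoff z₀ j) := fun j => by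
      rw [abs_le, ← smul_eq_mul, ← map_smul, ← map_neg]
      constructor <;>
      · refine hmono _ _ fun z => ?_
        have h4 := abs_le.1 (h.norm_coe_le_norm z)
        have h5 := farCutoff_nonneg z₀ j z
        simp only [BoundedContinuousFunction.coe_neg, Pi.neg_apply, Pi.mul_apply,
          BoundedContinuousFunction.coe_smul, smul_eq_mul, BoundedContinuousFunction.coe_mul]
        nlinarith
    have h4 : Tendsto (fun j : ℕ => g (h * farCutoff z₀ j)) atTop (𝓝 0) :=
      squeeze_zero_norm h3 (by simpa using ht.const_mul ‖h‖)
    have h5 : ∀ j : ℕ, g (h * (1 - farCutoff z₀ j)) = g h - g (h * farCutoff z₀ j) := fun j => by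
      rw [← map_sub, mul_sub, mul_one]
    simpa [h5] using h4.const_sub (g h)
  simp_rw [hcut] at h1
  exact tendsto_nhds_unique h1 h2

end Representation

/-! ### Couplings from dual bounds -/

section Coupling

variable {X : Type*} [MetricSpace X] [ProperSpace X] [MeasurableSpace X] [BorelSpace X]

/-- If the dual problem is bounded by `S`, there is a coupling of cost at most `S`. -/
theorem exists_coupling_of_dual_le [Nonempty X] {k : X → X → ℝ} (hk : IsMetricCost k)
    {m n : Measure X} [IsFiniteMeasure m] [IsFiniteMeasure n] {S : ℝ}
    (hS : ∀ ζ : X →ᵇ ℝ, IsAdmissible k ζ → ∫ x, ζ x ∂m - ∫ x, ζ x ∂n ≤ S) :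
    ∃ π : Measure (X × X), π.map Prod.fst = m ∧ π.map Prod.snd = n ∧
      ∫⁻ z, ENNReal.ofReal (k z.1 z.2) ∂π ≤ ENNReal.ofReal S := by
  obtain ⟨g, hg0, hg1, hg2⟩ := exists_coupling_functional hk hS
  have hmono : ∀ h h' : X × X →ᵇ ℝ, (∀ z, h z ≤ h' z) → g h ≤ g h' := fun h h' hh => by
    have := hg0 (h' - h) fun z => by simpa using hh z
    rw [map_sub] at this
    linarith
  obtain ⟨x₀⟩ := ‹Nonempty X›
  have hfst : ∀ φ : X →ᵇ ℝ, g (φ.compContinuous ⟨Prod.fst, continuous_fst⟩) = ∫ x, φ x ∂m :=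
    fun φ => by
      rw [hg1 _ φ 0 (fun z => by simp)]; simp
  have hsnd : ∀ φ : X →ᵇ ℝ, g (φ.compContinuous ⟨Prod.snd, continuous_snd⟩) = ∫ x, φ x ∂n :=
    fun φ => by
      rw [hg1 _ 0 φ (fun z => by simp)]; simp
  -- Tightness is inherited from the marginals: for the maximum metric on `X × X`, the cutoff of a
  -- pair equals the cutoff of one of its coordinates.
  have ht : Tendsto (fun j : ℕ => g (farCutoff (x₀, x₀) j)) atTop (𝓝 0) := by
    have h1 : ∀ j : ℕ, g (farCutoff (x₀, x₀) j) ≤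
        ∫ x, farCutoff x₀ j x ∂m + ∫ x, farCutoff x₀ j x ∂n := fun j => by
      rw [← hfst, ← hsnd, ← map_add]
      refine hmono _ _ fun z => ?_
      change farCutoff (x₀, x₀) j z ≤ farCutoff x₀ j z.1 + farCutoff x₀ j z.2
      rcases max_cases (dist z.1 x₀) (dist z.2 x₀) with ⟨h, -⟩ | ⟨h, -⟩
      · have : farCutoff (x₀, x₀) j z = farCutoff x₀ j z.1 := by
          rw [farCutoff_apply, farCutoff_apply, Prod.dist_eq, h]
        linarith [farCutoff_nonneg x₀ j z.2]
      · have : farCutoff (x₀, x₀) j z = farCutoff x₀ j z.2 := by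
          rw [farCutoff_apply, farCutoff_apply, Prod.dist_eq, h]
        linarith [farCutoff_nonneg x₀ j z.1]
    refine squeeze_zero (fun j => hg0 _ (farCutoff_nonneg _ _)) h1 ?_
    simpa using (tendsto_integral_farCutoff x₀ m).add (tendsto_integral_farCutoff x₀ n)
  obtain ⟨π, hπ, hgπ⟩ := exists_measure_of_tight_functional g hg0 (x₀, x₀) ht
  refine ⟨π, ?_, ?_, ?_⟩
  · have : IsFiniteMeasure (π.map Prod.fst) := Measure.isFiniteMeasure_map π _
    refine ext_of_forall_integral_eq_of_IsFiniteMeasure fun φ => ?_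
    rw [← hfst, ← hgπ, integral_map measurable_fst.aemeasurable
      φ.continuous.aestronglyMeasurable]
    rfl
  · have : IsFiniteMeasure (π.map Prod.snd) := Measure.isFiniteMeasure_map π _
    refine ext_of_forall_integral_eq_of_IsFiniteMeasure fun φ => ?_
    rw [← hsnd, ← hgπ, integral_map measurable_snd.aemeasurable
      φ.continuous.aestronglyMeasurable]
    rfl
  · have hkc : Continuous fun z : X × X => k z.1 z.2 := hk.continuous
    -- The measure represents `g` only on bounded functions, so the cost is truncated at `N` and
    -- recovered by monotone convergence.
    have h1 : ∀ N : ℕ, ∫⁻ z, ENNReal.ofReal (min (k z.1 z.2) N) ∂π ≤ ENNReal.ofReal S := fun N => by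
      let h : X × X →ᵇ ℝ := BoundedContinuousFunction.ofNormedAddCommGroup
        (fun z => min (k z.1 z.2) N) (hkc.min continuous_const) N fun z => by
          rw [Real.norm_eq_abs, abs_of_nonneg (le_min (hk.nonneg _ _) (Nat.cast_nonneg _))]
          exact min_le_right _ _
      have h2 : ∫⁻ z, ENNReal.ofReal (h z) ∂π = ENNReal.ofReal (∫ z, h z ∂π) :=
        (ofReal_integral_eq_lintegral_ofReal (h.integrable π)
          (.of_forall fun z => le_min (hk.nonneg _ _) (Nat.cast_nonneg _))).symm
      refine h2.le.trans (ENNReal.ofReal_le_ofReal ?_)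
      rw [hgπ]
      exact hg2 h fun z => min_le_left _ _
    have h3 : ∀ z : X × X, Tendsto (fun N : ℕ => ENNReal.ofReal (min (k z.1 z.2) N)) atTop
        (𝓝 (ENNReal.ofReal (k z.1 z.2))) := fun z => by
      obtain ⟨N, hN⟩ := exists_nat_ge (k z.1 z.2)
      refine tendsto_const_nhds.congr' ?_
      filter_upwards [eventually_ge_atTop N] with j hj
      rw [min_eq_left (hN.trans (by exact_mod_cast hj))]
    refine le_of_tendsto' (lintegral_tendsto_of_tendsto_of_monotone (fun N => ?_)
      (.of_forall fun z => ?_) (.of_forall h3)) h1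
    · exact (hkc.min continuous_const).measurable.ennreal_ofReal.aemeasurable
    · exact fun i j hij => ENNReal.ofReal_le_ofReal
        (min_le_min le_rfl (by exact_mod_cast hij))

end Coupling

/-! ### Kantorovich potentials -/

section Potential

variable {X : Type*} [MeasurableSpace X]

lemma isFiniteMeasure_of_map_fst {m : Measure X} [IsFiniteMeasure m]
    {π : Measure (X × X)} (h : π.map Prod.fst = m) : IsFiniteMeasure π := by
  refine ⟨?_⟩
  have := congrArg (fun ρ => ρ univ) h
  simp only [Measure.map_apply measurable_fst MeasurableSet.univ, preimage_univ] at this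
  rw [this]
  exact measure_lt_top _ _

variable [MetricSpace X] [BorelSpace X]

lemma integral_sub_eq_of_marginals {m n : Measure X} [IsFiniteMeasure m] [IsFiniteMeasure n]
    {π : Measure (X × X)} (h1 : π.map Prod.fst = m) (h2 : π.map Prod.snd = n) (ζ : X →ᵇ ℝ) :
    ∫ x, ζ x ∂m - ∫ x, ζ x ∂n = ∫ z, (ζ z.1 - ζ z.2) ∂π := by
  have i1 : Integrable (fun z : X × X => ζ z.1) π := by
    have := ζ.integrable m
    rw [← h1] at this
    exact this.comp_measurable measurable_fst
  have i2 : Integrable (fun z : X × X => ζ z.2) π := by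
    have := ζ.integrable n
    rw [← h2] at this
    exact this.comp_measurable measurable_snd
  rw [integral_sub i1 i2]
  congr 1
  · rw [← h1, integral_map measurable_fst.aemeasurable ζ.continuous.aestronglyMeasurable]
  · rw [← h2, integral_map measurable_snd.aemeasurable ζ.continuous.aestronglyMeasurable]

variable [ProperSpace X]

lemma IsMetricCost.integrable {k : X → X → ℝ} (hk : IsMetricCost k) {π : Measure (X × X)}
    (hc : ∫⁻ z, ENNReal.ofReal (k z.1 z.2) ∂π < ⊤) : Integrable (fun z => k z.1 z.2) π := by
  have hkc : Continuous fun z : X × X => k z.1 z.2 := hk.continuous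
  exact ⟨hkc.aestronglyMeasurable, (hasFiniteIntegral_iff_ofReal
    (.of_forall fun z => hk.nonneg _ _)).2 hc⟩

lemma IsMetricCost.ofReal_integral {k : X → X → ℝ} (hk : IsMetricCost k) {π : Measure (X × X)}
    (hc : ∫⁻ z, ENNReal.ofReal (k z.1 z.2) ∂π < ⊤) :
    ENNReal.ofReal (∫ z, k z.1 z.2 ∂π) = ∫⁻ z, ENNReal.ofReal (k z.1 z.2) ∂π :=
  ofReal_integral_eq_lintegral_ofReal (hk.integrable hc) (.of_forall fun _ => hk.nonneg _ _)

/-- Existence of Kantorovich potentials for optimal plans of finite cost. -/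
theorem exists_potential [Nonempty X] {k : X → X → ℝ} (hk : IsMetricCost k) {m n : Measure X}
    [IsFiniteMeasure m] [IsFiniteMeasure n] {π : Measure (X × X)}
    (h1 : π.map Prod.fst = m) (h2 : π.map Prod.snd = n)
    (hc : ∫⁻ z, ENNReal.ofReal (k z.1 z.2) ∂π < ⊤)
    (hopt : ∀ π' : Measure (X × X), π'.map Prod.fst = m → π'.map Prod.snd = n →
      ∫⁻ z, ENNReal.ofReal (k z.1 z.2) ∂π ≤ ∫⁻ z, ENNReal.ofReal (k z.1 z.2) ∂π') :
    ∃ ζ : X → ℝ, IsAdmissible k ζ ∧ ∀ᵐ z ∂π, ζ z.1 - ζ z.2 = k z.1 z.2 := by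
  have hπ := isFiniteMeasure_of_map_fst h1
  have hki := hk.integrable hc
  set C := ∫ z, k z.1 z.2 ∂π with hC
  have hε : ∀ ε : ℝ, 0 < ε → ∃ ζ : X →ᵇ ℝ, IsAdmissible k ζ ∧
      C - ε < ∫ x, ζ x ∂m - ∫ x, ζ x ∂n := fun ε hε => by
    by_contra! hcon
    obtain ⟨π', h3, h4, h5⟩ := exists_coupling_of_dual_le hk hcon
    -- Testing the assumed dual bound with `ζ = 0` makes `C - ε` nonnegative, so that
    -- `ENNReal.ofReal` does not truncate it in the comparison with the optimal cost.
    have h6 : 0 ≤ C - ε := by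
      simpa using hcon 0 fun x y => by simpa using hk.nonneg x y
    have h7 := (hopt π' h3 h4).trans h5
    rw [← hk.ofReal_integral hc, ENNReal.ofReal_le_ofReal_iff h6] at h7
    linarith
  -- The duality gaps are summable, so the defects `f j` tend to `0` almost everywhere without
  -- passing to a subsequence.
  choose ζ hζ hζC using fun j : ℕ => hε ((1 / 2) ^ j) (by positivity)
  let f : ℕ → X × X → ℝ := fun j z => k z.1 z.2 - (ζ j z.1 - ζ j z.2)
  have hkc : Continuous fun z : X × X => k z.1 z.2 := hk.continuous
  have hf0 : ∀ j z, 0 ≤ f j z := fun j z => sub_nonneg.2 ((le_abs_self _).trans (hζ j _ _))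
  have hfc : ∀ j, Continuous (f j) := fun j => by fun_prop
  have hζi : ∀ j, Integrable (fun z : X × X => ζ j z.1 - ζ j z.2) π := fun j =>
    hki.mono' (by fun_prop : Continuous fun z : X × X => ζ j z.1 - ζ j z.2).aestronglyMeasurable
      (.of_forall fun z => hζ j _ _)
  have hfi : ∀ j, ∫⁻ z, ENNReal.ofReal (f j z) ∂π ≤ ENNReal.ofReal ((1 / 2) ^ j) := fun j => by
    have hfj : Integrable (f j) π := hki.sub (hζi j)
    rw [← ofReal_integral_eq_lintegral_ofReal hfj (.of_forall (hf0 j))]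
    refine ENNReal.ofReal_le_ofReal ?_
    simp only [f]
    rw [integral_sub hki (hζi j), ← integral_sub_eq_of_marginals h1 h2]
    linarith [hζC j]
  have hsum : ∫⁻ z, ∑' j, ENNReal.ofReal (f j z) ∂π ≠ ⊤ := by
    rw [lintegral_tsum fun j => (hfc j).measurable.ennreal_ofReal.aemeasurable]
    refine ne_top_of_le_ne_top ?_ (ENNReal.tsum_le_tsum hfi)
    rw [← ENNReal.ofReal_tsum_of_nonneg (fun j => by positivity) summable_geometric_two]
    exact ENNReal.ofReal_ne_top
  have hae : ∀ᵐ z ∂π, Tendsto (fun j => f j z) atTop (𝓝 0) := by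
    filter_upwards [ae_lt_top' (AEMeasurable.tsum fun j =>
      (hfc j).measurable.ennreal_ofReal.aemeasurable) hsum] with z hz
    have h3 := ENNReal.tendsto_atTop_zero_of_tsum_ne_top hz.ne
    have h4 := (ENNReal.tendsto_toReal ENNReal.zero_ne_top).comp h3
    refine h4.congr fun j => ?_
    simp [ENNReal.toReal_ofReal (hf0 j z)]
  obtain ⟨x₀⟩ := ‹Nonempty X›
  -- Normalised at `x₀`, the values at `x` stay in `[-k x x₀, k x x₀]`; a single ultrafilter makes
  -- them converge at all points simultaneously.
  have hlim : ∀ x, ∃ l, Tendsto (fun j => ζ j x - ζ j x₀) (hyperfilter ℕ) (𝓝 l) := fun x => by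
    have h3 : IsCompact (Icc (-k x x₀) (k x x₀)) := isCompact_Icc
    obtain ⟨l, -, hl⟩ := h3.ultrafilter_le_nhds
      ((hyperfilter ℕ).map fun j => ζ j x - ζ j x₀) (by
        rw [le_principal_iff, Ultrafilter.mem_coe, Ultrafilter.mem_map]
        exact univ_mem' fun j => abs_le.1 (hζ j x x₀))
    exact ⟨l, hl⟩
  choose z hz using hlim
  have hdiff : ∀ x y, Tendsto (fun j => ζ j x - ζ j y) (hyperfilter ℕ) (𝓝 (z x - z y)) :=
    fun x y => ((hz x).sub (hz y)).congr fun j => by ring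
  refine ⟨z, fun x y => le_of_tendsto (hdiff x y).abs (.of_forall fun j => hζ j x y), ?_⟩
  filter_upwards [hae] with p hp
  have h3 := (hp.mono_left (Nat.hyperfilter_le_atTop)).const_sub (k p.1 p.2)
  simp only [f, sub_sub_cancel, sub_zero] at h3
  exact tendsto_nhds_unique (hdiff _ _) h3

end Potential

/-! ### Concave costs -/

section Cost

variable {c : ℝ → ℝ}

lemma IsConcaveCost.mul_le (hc : IsConcaveCost c) {r z : ℝ} (hr0 : 0 ≤ r) (hr1 : r ≤ 1)
    (hz : 0 ≤ z) : r * c z ≤ c (r * z) := by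
  have := hc.strictConcave.concaveOn.2 (mem_Ici.2 le_rfl) (mem_Ici.2 hz)
    (sub_nonneg.2 hr1) hr0 (by ring)
  simpa [hc.zero] using this

/-- A concave function that decreased somewhere would become negative far out. Concretely, `b` is a
convex combination of `a`, with weight tending to `1`, and a far point where `c ≥ 0`. -/
lemma IsConcaveCost.mono (hc : IsConcaveCost c) {a b : ℝ} (ha : 0 ≤ a) (hab : a ≤ b) :
    c a ≤ c b := by
  have h : ∀ N : ℕ, (1 - 1 / ((N : ℝ) + 1)) * c a ≤ c b := fun N => by
    have hN : (0 : ℝ) < N + 1 := by positivity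
    have h1 : 1 / ((N : ℝ) + 1) ≤ 1 := by
      rw [div_le_one hN]; linarith [(Nat.cast_nonneg N : (0 : ℝ) ≤ N)]
    have hx : 0 ≤ a + (N + 1) * (b - a) := by
      have := mul_nonneg hN.le (sub_nonneg.2 hab); linarith
    have h2 := hc.strictConcave.concaveOn.2 (mem_Ici.2 ha) (mem_Ici.2 hx)
      (sub_nonneg.2 h1) (by positivity : 0 ≤ 1 / ((N : ℝ) + 1)) (by ring)
    have h3 : (1 - 1 / ((N : ℝ) + 1)) • a + (1 / ((N : ℝ) + 1)) • (a + (N + 1) * (b - a)) = b := by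
      simp only [smul_eq_mul]; field_simp; ring
    rw [h3] at h2
    have h4 : 0 ≤ 1 / ((N : ℝ) + 1) * c (a + (N + 1) * (b - a)) :=
      mul_nonneg (by positivity) (hc.nonneg _ hx)
    simp only [smul_eq_mul] at h2
    linarith
  have h5 : Tendsto (fun N : ℕ => (1 - 1 / ((N : ℝ) + 1)) * c a) atTop (𝓝 ((1 - 0) * c a)) :=
    (tendsto_one_div_add_atTop_nhds_zero_nat.const_sub 1).mul_const _
  simpa using le_of_tendsto' h5 h

/-- By concavity and `c 0 = 0`, each summand carries at least its proportional share of `c (a + b)`.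
This gives the triangle inequality for the cost. -/
lemma IsConcaveCost.add_le (hc : IsConcaveCost c) {a b : ℝ} (ha : 0 ≤ a) (hb : 0 ≤ b) :
    c (a + b) ≤ c a + c b := by
  rcases (add_nonneg ha hb).eq_or_lt with h | h
  · have := hc.nonneg a ha
    have := hc.nonneg b hb
    rw [← h, hc.zero]; linarith
  · have h1 := hc.mul_le (div_nonneg ha h.le) (by rw [div_le_one h]; linarith) h.le
    have h2 := hc.mul_le (div_nonneg hb h.le) (by rw [div_le_one h]; linarith) h.le
    rw [div_mul_cancel₀ _ h.ne'] at h1 h2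
    have h3 : a / (a + b) * c (a + b) + b / (a + b) * c (a + b) = c (a + b) := by field_simp
    linarith

lemma IsConcaveCost.exists_le_mul (hc : IsConcaveCost c) :
    ∃ L : ℝ≥0, ∀ z, 0 ≤ z → c z ≤ L * z := by
  obtain ⟨L, hL⟩ := hc.lipschitz
  refine ⟨L, fun z hz => ?_⟩
  have := hL.dist_le_mul z hz 0 (mem_Ici.2 le_rfl)
  rw [hc.zero, Real.dist_eq, Real.dist_eq, sub_zero, sub_zero, abs_of_nonneg hz] at this
  exact (le_abs_self _).trans this

lemma IsConcaveCost.isMetricCost (hc : IsConcaveCost c) (X : Type*) [MetricSpace X] :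
    IsMetricCost fun x y : X => c (dist x y) where
  continuous := by
    obtain ⟨L, hL⟩ := hc.lipschitz
    exact hL.continuousOn.comp_continuous continuous_dist fun _ => dist_nonneg
  self x := by simp [hc.zero]
  nonneg x y := hc.nonneg _ dist_nonneg
  symm x y := by rw [dist_comm]
  triangle x y z := (hc.mono dist_nonneg (dist_triangle x y z)).trans
    (hc.add_le dist_nonneg dist_nonneg)

lemma IsAdmissible.lipschitzWith {X : Type*} [MetricSpace X] {L : ℝ≥0}
    (hL : ∀ z, 0 ≤ z → c z ≤ L * z) {ζ : X → ℝ}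
    (hζ : IsAdmissible (fun x y : X => c (dist x y)) ζ) : LipschitzWith L ζ :=
  LipschitzWith.of_dist_le_mul fun x y => (hζ x y).trans (hL _ dist_nonneg)

/-- Truncation of a function at height `N`. -/
noncomputable def clampFun {X : Type*} (N : ℕ) (ζ : X → ℝ) : X → ℝ :=
  fun x => max (-N) (min N (ζ x))

lemma abs_clampFun_le {X : Type*} (N : ℕ) (ζ : X → ℝ) (x : X) : |clampFun N ζ x| ≤ N := by
  have : (0 : ℝ) ≤ N := Nat.cast_nonneg N
  exact abs_le.2 ⟨le_max_left _ _, max_le (by linarith) (min_le_left _ _)⟩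

lemma abs_clampFun_sub_le {X : Type*} (N : ℕ) (ζ : X → ℝ) (x y : X) :
    |clampFun N ζ x - clampFun N ζ y| ≤ |ζ x - ζ y| := by
  have h1 := abs_max_sub_max_le_abs (min (N : ℝ) (ζ x)) (min N (ζ y)) (-N)
  have h2 := abs_min_sub_min_le_max (N : ℝ) (ζ x) N (ζ y)
  simp only [sub_self, abs_zero] at h2
  rw [max_eq_right (abs_nonneg _)] at h2
  unfold clampFun
  rw [max_comm, max_comm (-(N : ℝ)) (min N (ζ y))]
  exact h1.trans h2

lemma clampFun_eq {X : Type*} {N : ℕ} {ζ : X → ℝ} {x : X} (h : |ζ x| ≤ N) :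
    clampFun N ζ x = ζ x := by
  rw [abs_le] at h
  rw [clampFun, min_eq_right h.2, max_eq_right h.1]

lemma tendsto_clampFun {X : Type*} (ζ : X → ℝ) (x : X) :
    Tendsto (fun N : ℕ => clampFun N ζ x) atTop (𝓝 (ζ x)) := by
  obtain ⟨N, hN⟩ := exists_nat_ge |ζ x|
  refine tendsto_const_nhds.congr' ?_
  filter_upwards [eventually_ge_atTop N] with j hj
  exact (clampFun_eq (hN.trans (by exact_mod_cast hj))).symm

lemma IsAdmissible.clampFun {X : Type*} {k : X → X → ℝ} {ζ : X → ℝ} (h : IsAdmissible k ζ)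
    (N : ℕ) : IsAdmissible k (clampFun N ζ) := fun x y =>
  (abs_clampFun_sub_le N ζ x y).trans (h x y)

end Cost

/-! ### The transport distance of signed densities -/

section TransportDist

variable {d : ℕ} {c : ℝ → ℝ} {μ ν : Rd d → ℝ}

lemma isFiniteMeasure_sourceMeasure (hμ : Integrable μ) (hν : Integrable ν) :
    IsFiniteMeasure (sourceMeasure μ ν) := by
  refine isFiniteMeasure_withDensity ?_
  rw [lintegral_add_left' hμ.aestronglyMeasurable.aemeasurable.ennreal_ofReal]
  exact (ENNReal.add_lt_top.2 ⟨hμ.lintegral_lt_top, hν.neg.lintegral_lt_top⟩).ne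

lemma integral_sourceMeasure (hμ : Integrable μ) (hν : Integrable ν) (ζ : Rd d → ℝ) :
    ∫ x, ζ x ∂(sourceMeasure μ ν) = ∫ x, (max (μ x) 0 + max (-ν x) 0) * ζ x := by
  have hm : AEMeasurable (fun x => ENNReal.ofReal (μ x) + ENNReal.ofReal (-ν x)) volume :=
    hμ.aestronglyMeasurable.aemeasurable.ennreal_ofReal.add
      hν.aestronglyMeasurable.aemeasurable.neg.ennreal_ofReal
  rw [sourceMeasure, integral_withDensity_eq_integral_toReal_smul₀ hm
    (.of_forall fun x => ENNReal.add_lt_top.2 ⟨ENNReal.ofReal_lt_top, ENNReal.ofReal_lt_top⟩)]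
  refine integral_congr_ae (.of_forall fun x => ?_)
  simp only [smul_eq_mul]
  rw [ENNReal.toReal_add ENNReal.ofReal_ne_top ENNReal.ofReal_ne_top, ENNReal.toReal_ofReal',
    ENNReal.toReal_ofReal']

/-- Because `(μ⁺ + ν⁻) - (ν⁺ + μ⁻) = μ - ν`, the dual problem sees only the signed difference, which
is the quantity that evolves linearly in time. -/
lemma integral_sourceMeasure_sub (hμ : Integrable μ) (hν : Integrable ν) (ζ : Rd d →ᵇ ℝ) :
    ∫ x, ζ x ∂(sourceMeasure μ ν) - ∫ x, ζ x ∂(sourceMeasure ν μ) = ∫ x, ζ x * (μ x - ν x) := by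
  rw [integral_sourceMeasure hμ hν, integral_sourceMeasure hν hμ, ← integral_sub]
  · refine integral_congr_ae (.of_forall fun x => ?_)
    simp only
    have h : ∀ a : ℝ, max a 0 - max (-a) 0 = a := fun a => by
      rcases le_total a 0 with h | h <;> simp [h]
    linear_combination ζ x * h (μ x) - ζ x * h (ν x)
  · exact (hμ.pos_part.add hν.neg.pos_part).mul_bdd (c := ‖ζ‖)
      ζ.continuous.aestronglyMeasurable (.of_forall ζ.norm_coe_le_norm)
  · exact (hν.pos_part.add hμ.neg.pos_part).mul_bdd (c := ‖ζ‖)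
      ζ.continuous.aestronglyMeasurable (.of_forall ζ.norm_coe_le_norm)

/-- A bounded admissible function, as a bounded continuous function. -/
lemma IsAdmissible.exists_boundedContinuousFunction {k : Rd d → Rd d → ℝ} (hk : IsMetricCost k)
    {ζ : Rd d → ℝ} (h : IsAdmissible k ζ) {C : ℝ} (hC : ∀ x, |ζ x| ≤ C) :
    ∃ ζ' : Rd d →ᵇ ℝ, ∀ x, ζ' x = ζ x :=
  ⟨BoundedContinuousFunction.ofNormedAddCommGroup ζ (h.continuous hk) C hC, fun _ => rfl⟩

lemma exists_plan_of_dual_le (hc : IsConcaveCost c) (hμ : Integrable μ) (hν : Integrable ν) {S : ℝ}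
    (hS : ∀ ζ : Rd d → ℝ, IsAdmissible (fun x y => c (dist x y)) ζ → (∃ C, ∀ x, |ζ x| ≤ C) →
      ∫ x, ζ x * (μ x - ν x) ≤ S) :
    ∃ π ∈ densityPlans μ ν, planCost c π ≤ ENNReal.ofReal S := by
  have := isFiniteMeasure_sourceMeasure hμ hν
  have := isFiniteMeasure_sourceMeasure hν hμ
  obtain ⟨π, h1, h2, h3⟩ := exists_coupling_of_dual_le (hc.isMetricCost (Rd d))
    (m := sourceMeasure μ ν) (n := sourceMeasure ν μ) (S := S) fun ζ hζ => by
      rw [integral_sourceMeasure_sub hμ hν]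
      exact hS ζ hζ ⟨‖ζ‖, ζ.norm_coe_le_norm⟩
  exact ⟨π, ⟨h1, h2⟩, h3⟩

lemma transportDist_le_of_dual_le (hc : IsConcaveCost c) (hμ : Integrable μ) (hν : Integrable ν)
    {S : ℝ}
    (hS : ∀ ζ : Rd d → ℝ, IsAdmissible (fun x y => c (dist x y)) ζ → (∃ C, ∀ x, |ζ x| ≤ C) →
      ∫ x, ζ x * (μ x - ν x) ≤ S) :
    transportDist c μ ν ≤ ENNReal.ofReal S := by
  obtain ⟨π, h1, h2⟩ := exists_plan_of_dual_le hc hμ hν hS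
  exact (iInf₂_le π h1).trans h2

lemma integral_eq_integral_plan (hc : IsConcaveCost c) (hμ : Integrable μ) (hν : Integrable ν)
    {π : Measure (Rd d × Rd d)} (hπ : π ∈ densityPlans μ ν) {ζ : Rd d → ℝ}
    (hζ : IsAdmissible (fun x y => c (dist x y)) ζ) {C : ℝ} (hC : ∀ x, |ζ x| ≤ C) :
    ∫ x, ζ x * (μ x - ν x) = ∫ z, (ζ z.1 - ζ z.2) ∂π := by
  have := isFiniteMeasure_sourceMeasure hμ hν
  have := isFiniteMeasure_sourceMeasure hν hμ
  obtain ⟨ζ', h'⟩ := hζ.exists_boundedContinuousFunction (hc.isMetricCost _) hC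
  simp_rw [← h']
  rw [← integral_sourceMeasure_sub hμ hν, integral_sub_eq_of_marginals hπ.1 hπ.2]

/-- Passage to unbounded admissible functions, by truncation. -/
lemma tendsto_integral_clampFun (hc : IsConcaveCost c) (hμ : Integrable μ) (hν : Integrable ν)
    {π : Measure (Rd d × Rd d)} (hπ : π ∈ densityPlans μ ν) (hcost : planCost c π < ⊤)
    {ζ : Rd d → ℝ} (hζ : IsAdmissible (fun x y => c (dist x y)) ζ) :
    Tendsto (fun N : ℕ => ∫ x, clampFun N ζ x * (μ x - ν x)) atTop
      (𝓝 (∫ z, (ζ z.1 - ζ z.2) ∂π)) := by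
  have hk := hc.isMetricCost (Rd d)
  simp_rw [fun N => integral_eq_integral_plan hc hμ hν hπ (hζ.clampFun N) (abs_clampFun_le N ζ)]
  refine tendsto_integral_of_dominated_convergence (fun z => c (dist z.1 z.2)) (fun N => ?_)
    (hk.integrable hcost) (fun N => .of_forall fun z => hζ.clampFun N _ _)
    (.of_forall fun z => (tendsto_clampFun ζ z.1).sub (tendsto_clampFun ζ z.2))
  have := (hζ.clampFun N).continuous hk
  exact (by fun_prop : Continuous fun z : Rd d × Rd d =>
    clampFun N ζ z.1 - clampFun N ζ z.2).aestronglyMeasurable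

lemma integral_plan_le (hc : IsConcaveCost c)
    {π : Measure (Rd d × Rd d)} (hcost : planCost c π < ⊤)
    {ζ : Rd d → ℝ} (hζ : IsAdmissible (fun x y => c (dist x y)) ζ) :
    ∫ z, (ζ z.1 - ζ z.2) ∂π ≤ (planCost c π).toReal := by
  have hk := hc.isMetricCost (Rd d)
  have hζc := hζ.continuous hk
  have hi := hk.integrable hcost
  have h1 : ENNReal.ofReal (∫ z, c (dist z.1 z.2) ∂π) = planCost c π := hk.ofReal_integral hcost
  rw [← h1, ENNReal.toReal_ofReal (integral_nonneg fun z => hk.nonneg _ _)]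
  exact integral_mono (hi.mono' (by fun_prop : Continuous fun z : Rd d × Rd d =>
    ζ z.1 - ζ z.2).aestronglyMeasurable (.of_forall fun z => hζ _ _)) hi
    fun z => (le_abs_self _).trans (hζ _ _)

lemma integral_le_transportDist (hc : IsConcaveCost c) (hμ : Integrable μ) (hν : Integrable ν)
    (hfin : transportDist c μ ν < ⊤) {ζ : Rd d → ℝ}
    (hζ : IsAdmissible (fun x y => c (dist x y)) ζ) {C : ℝ} (hC : ∀ x, |ζ x| ≤ C) :
    ∫ x, ζ x * (μ x - ν x) ≤ (transportDist c μ ν).toReal := by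
  rw [← ENNReal.ofReal_le_iff_le_toReal hfin.ne]
  refine le_iInf₂ fun π hπ => ?_
  rcases eq_top_or_lt_top (planCost c π) with h | h
  · rw [h]; exact le_top
  · rw [ENNReal.ofReal_le_iff_le_toReal h.ne, integral_eq_integral_plan hc hμ hν hπ hζ hC]
    exact integral_plan_le hc h hζ

/-- By weak duality the infimum itself bounds the dual problem, so duality with this bound yields a
minimiser; no separate compactness argument for plans is needed. -/
lemma exists_optimal_plan (hc : IsConcaveCost c) (hμ : Integrable μ) (hν : Integrable ν)
    (hfin : transportDist c μ ν < ⊤) :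
    ∃ π ∈ densityPlans μ ν, planCost c π = transportDist c μ ν := by
  obtain ⟨π, h1, h2⟩ := exists_plan_of_dual_le hc hμ hν fun ζ hζ ⟨C, hC⟩ =>
    integral_le_transportDist hc hμ hν hfin hζ hC
  rw [ENNReal.ofReal_toReal hfin.ne] at h2
  exact ⟨π, h1, h2.antisymm (iInf₂_le π h1)⟩

lemma exists_isKantorovichPotential (hc : IsConcaveCost c) (hμ : Integrable μ) (hν : Integrable ν)
    (hfin : transportDist c μ ν < ⊤) : ∃ ζ, IsKantorovichPotential c μ ν ζ := by
  have := isFiniteMeasure_sourceMeasure hμ hν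
  have := isFiniteMeasure_sourceMeasure hν hμ
  obtain ⟨π, hπ, hopt⟩ := exists_optimal_plan hc hμ hν hfin
  obtain ⟨ζ, h1, h2⟩ := exists_potential (hc.isMetricCost (Rd d)) hπ.1 hπ.2
    (hopt.trans_lt hfin) fun π' h3 h4 => hopt.le.trans (iInf₂_le π' ⟨h3, h4⟩)
  exact ⟨ζ, h1, π, hπ, hopt, h2⟩

/-- Admissible functions give lower bounds for the transport distance. -/
lemma exists_tendsto_clampFun_le (hc : IsConcaveCost c) (hμ : Integrable μ) (hν : Integrable ν)
    (hfin : transportDist c μ ν < ⊤) {ζ : Rd d → ℝ}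
    (hζ : IsAdmissible (fun x y => c (dist x y)) ζ) :
    ∃ l ≤ (transportDist c μ ν).toReal,
      Tendsto (fun N : ℕ => ∫ x, clampFun N ζ x * (μ x - ν x)) atTop (𝓝 l) := by
  obtain ⟨π, hπ, hopt⟩ := exists_optimal_plan hc hμ hν hfin
  rw [← hopt] at hfin ⊢
  exact ⟨_, integral_plan_le hc hfin hζ, tendsto_integral_clampFun hc hμ hν hπ hfin hζ⟩

/-- Kantorovich potentials realize the transport distance. -/
lemma IsKantorovichPotential.tendsto_clampFun (hc : IsConcaveCost c) (hμ : Integrable μ)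
    (hν : Integrable ν) (hfin : transportDist c μ ν < ⊤) {ζ : Rd d → ℝ}
    (hζ : IsKantorovichPotential c μ ν ζ) :
    Tendsto (fun N : ℕ => ∫ x, clampFun N ζ x * (μ x - ν x)) atTop
      (𝓝 (transportDist c μ ν).toReal) := by
  obtain ⟨hadm, π, hπ, hopt, hae⟩ := hζ
  rw [← hopt] at hfin ⊢
  have h1 := tendsto_integral_clampFun hc hμ hν hπ hfin hadm
  have hk := hc.isMetricCost (Rd d)
  have h2 : ENNReal.ofReal (∫ z, c (dist z.1 z.2) ∂π) = planCost c π := hk.ofReal_integral hfin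
  rwa [integral_congr_ae hae, ← ENNReal.toReal_ofReal (integral_nonneg fun z => hk.nonneg _ _),
    h2] at h1

end TransportDist

/-! ### Integration by parts against bounded Lipschitz functions -/

section Extension

open ContinuousLinearMap Convolution

variable {d : ℕ}

lemma norm_gradient_le_of_lipschitz {ζ : Rd d → ℝ} {K : ℝ≥0} (h : LipschitzWith K ζ) (x : Rd d) :
    ‖gradient ζ x‖ ≤ K := by
  rw [gradient, LinearIsometryEquiv.norm_map]
  exact norm_fderiv_le_of_lipschitz ℝ h

lemma measurable_gradient (ζ : Rd d → ℝ) : Measurable (gradient ζ) :=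
  (LinearIsometryEquiv.continuous _).measurable.comp (measurable_fderiv ℝ ζ)

lemma gradient_congr_of_eventuallyEq {ζ ξ : Rd d → ℝ} {x : Rd d} (h : ζ =ᶠ[𝓝 x] ξ) :
    gradient ζ x = gradient ξ x := by
  rw [gradient, gradient, h.fderiv_eq]

lemma integrable_mul_of_bounded {α ζ : Rd d → ℝ} (hα : Integrable α) (hζ : Continuous ζ) {C : ℝ}
    (hC : ∀ x, |ζ x| ≤ C) : Integrable fun x => ζ x * α x :=
  hα.bdd_mul hζ.aestronglyMeasurable (.of_forall hC)

lemma integrable_inner_gradient {Φ : Rd d → Rd d} (hΦ : Integrable Φ) {ζ : Rd d → ℝ} {K : ℝ≥0}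
    (hζ : LipschitzWith K ζ) : Integrable fun x => inner ℝ (gradient ζ x) (Φ x) := by
  refine (hΦ.norm.const_mul K).mono'
    ((measurable_gradient ζ).aestronglyMeasurable.inner hΦ.aestronglyMeasurable)
    (.of_forall fun x => (norm_inner_le_norm _ _).trans ?_)
  exact mul_le_mul_of_nonneg_right (norm_gradient_le_of_lipschitz hζ x) (norm_nonneg _)

/-- `div Φ = -α` tested against `ζ`. -/
def WeakDivAgainst (α : Rd d → ℝ) (Φ : Rd d → Rd d) (ζ : Rd d → ℝ) : Prop :=
  ∫ x, ζ x * α x = ∫ x, inner ℝ (gradient ζ x) (Φ x)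

/-- Dominated convergence: the common bound controls the left side, and the common Lipschitz
constant controls the gradients. -/
lemma weakDivAgainst_of_tendsto {α : Rd d → ℝ} {Φ : Rd d → Rd d} (hα : Integrable α)
    (hΦ : Integrable Φ) {ζs : ℕ → Rd d → ℝ} {ζ : Rd d → ℝ} {C : ℝ} {K : ℝ≥0}
    (hC : ∀ n x, |ζs n x| ≤ C) (hK : ∀ n, LipschitzWith K (ζs n))
    (hlim : ∀ x, Tendsto (fun n => ζs n x) atTop (𝓝 (ζ x)))
    (hgrad : ∀ᵐ x, Tendsto (fun n => gradient (ζs n) x) atTop (𝓝 (gradient ζ x)))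
    (h : ∀ n, WeakDivAgainst α Φ (ζs n)) : WeakDivAgainst α Φ ζ := by
  have h1 : Tendsto (fun n => ∫ x, ζs n x * α x) atTop (𝓝 (∫ x, ζ x * α x)) := by
    refine tendsto_integral_of_dominated_convergence (fun x => C * |α x|)
      (fun n => (integrable_mul_of_bounded hα (hK n).continuous (hC n)).aestronglyMeasurable)
      (hα.abs.const_mul C) (fun n => .of_forall fun x => ?_)
      (.of_forall fun x => (hlim x).mul_const _)
    rw [norm_mul]
    exact mul_le_mul_of_nonneg_right (hC n x) (abs_nonneg _)
  have h2 : Tendsto (fun n => ∫ x, inner ℝ (gradient (ζs n) x) (Φ x)) atTop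
      (𝓝 (∫ x, inner ℝ (gradient ζ x) (Φ x))) := by
    refine tendsto_integral_of_dominated_convergence (fun x => K * ‖Φ x‖)
      (fun n => (integrable_inner_gradient hΦ (hK n)).aestronglyMeasurable)
      (hΦ.norm.const_mul K) (fun n => .of_forall fun x => (norm_inner_le_norm _ _).trans ?_) ?_
    · exact mul_le_mul_of_nonneg_right (norm_gradient_le_of_lipschitz (hK n) x) (norm_nonneg _)
    · filter_upwards [hgrad] with x hx
      exact hx.inner tendsto_const_nhds
  exact tendsto_nhds_unique (h1.congr h) h2

/-- Bump functions with support shrinking to `0`. -/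
noncomputable def mollifier (d n : ℕ) : ContDiffBump (0 : Rd d) where
  rIn := 1 / ((n : ℝ) + 1)
  rOut := 2 * (1 / ((n : ℝ) + 1))
  rIn_pos := by positivity
  rIn_lt_rOut := by
    have : 0 < 1 / ((n : ℝ) + 1) := by positivity
    linarith

lemma tendsto_mollifier_rOut (d : ℕ) : Tendsto (fun n => (mollifier d n).rOut) atTop (𝓝 0) := by
  have := (tendsto_one_div_add_atTop_nhds_zero_nat (𝕜 := ℝ)).const_mul 2
  rwa [mul_zero] at this

/-- Mollification of a function. -/
noncomputable def mollify {F : Type*} [NormedAddCommGroup F] [NormedSpace ℝ F] (n : ℕ)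
    (f : Rd d → F) : Rd d → F :=
  (mollifier d n).normed volume ⋆[lsmul ℝ ℝ, volume] f

lemma mollify_apply {F : Type*} [NormedAddCommGroup F] [NormedSpace ℝ F] (n : ℕ)
    (f : Rd d → F) (x : Rd d) :
    mollify n f x = ∫ y, (mollifier d n).normed volume y • f (x - y) := rfl

lemma integrable_mollifier_smul {F : Type*} [NormedAddCommGroup F] [NormedSpace ℝ F] (n : ℕ)
    {f : Rd d → F} (hf : AEStronglyMeasurable f) {C : ℝ} (hC : ∀ x, ‖f x‖ ≤ C) (x : Rd d) :
    Integrable fun y => (mollifier d n).normed volume y • f (x - y) :=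
  (mollifier d n).integrable_normed.smul_bdd C
    (hf.comp_quasiMeasurePreserving (quasiMeasurePreserving_sub_left volume x))
    (.of_forall fun _ => hC _)

lemma norm_mollify_le {F : Type*} [NormedAddCommGroup F] [NormedSpace ℝ F] (n : ℕ)
    {f : Rd d → F} {C : ℝ} (hC : ∀ x, ‖f x‖ ≤ C) (x : Rd d) : ‖mollify n f x‖ ≤ C := by
  rw [mollify_apply]
  refine (norm_integral_le_of_norm_le ((mollifier d n).integrable_normed.mul_const C)
    (.of_forall fun y => ?_)).trans (by rw [integral_mul_const, ContDiffBump.integral_normed, one_mul])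
  rw [norm_smul, Real.norm_of_nonneg ((mollifier d n).nonneg_normed y)]
  exact mul_le_mul_of_nonneg_left (hC _) ((mollifier d n).nonneg_normed y)

lemma lipschitzWith_mollify (n : ℕ) {ζ : Rd d → ℝ} {K : ℝ≥0} (hζ : LipschitzWith K ζ) {C : ℝ}
    (hC : ∀ x, |ζ x| ≤ C) : LipschitzWith K (mollify n ζ) := by
  refine LipschitzWith.of_dist_le_mul fun x x' => ?_
  have hm := hζ.continuous.aestronglyMeasurable (μ := (volume : Measure (Rd d)))
  rw [dist_eq_norm, mollify_apply, mollify_apply, ← integral_sub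
    (integrable_mollifier_smul n hm hC x) (integrable_mollifier_smul n hm hC x')]
  refine (norm_integral_le_of_norm_le ((mollifier d n).integrable_normed.mul_const (K * dist x x'))
    (.of_forall fun y => ?_)).trans (by rw [integral_mul_const, ContDiffBump.integral_normed, one_mul])
  rw [← smul_sub, norm_smul, Real.norm_of_nonneg ((mollifier d n).nonneg_normed y), ← dist_eq_norm]
  refine mul_le_mul_of_nonneg_left ?_ ((mollifier d n).nonneg_normed y)
  simpa using hζ.dist_le_mul (x - y) (x' - y)

/-- By Rademacher's theorem `ζ` is differentiable almost everywhere, and its Lipschitz constant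
permits differentiation under the integral. -/
lemma fderiv_mollify (n : ℕ) {ζ : Rd d → ℝ} {K : ℝ≥0} (hζ : LipschitzWith K ζ) {C : ℝ}
    (hC : ∀ x, |ζ x| ≤ C) (x : Rd d) : fderiv ℝ (mollify n ζ) x = mollify n (fderiv ℝ ζ) x := by
  have hm := hζ.continuous.aestronglyMeasurable (μ := (volume : Measure (Rd d)))
  refine HasFDerivAt.fderiv ?_
  refine (hasFDerivAt_integral_of_dominated_loc_of_lip (s := univ)
    (bound := fun y => (mollifier d n).normed volume y * K) univ_mem
    (.of_forall fun x' => (integrable_mollifier_smul n hm hC x').aestronglyMeasurable)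
    (integrable_mollifier_smul n hm hC x)
    (integrable_mollifier_smul n (measurable_fderiv ℝ ζ).aestronglyMeasurable
      (fun y => norm_fderiv_le_of_lipschitz ℝ hζ) x).aestronglyMeasurable ?_
    ((mollifier d n).integrable_normed.mul_const _) ?_).2
  · refine .of_forall fun y => LipschitzWith.lipschitzOnWith
      (LipschitzWith.of_dist_le_mul fun a b => ?_)
    have h0 := (mollifier d n).nonneg_normed (μ := volume) y
    rw [Real.coe_nnabs, abs_of_nonneg (mul_nonneg h0 K.coe_nonneg), dist_smul₀, Real.norm_of_nonneg h0,
      mul_assoc]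
    refine mul_le_mul_of_nonneg_left ?_ h0
    simpa using hζ.dist_le_mul (a - y) (b - y)
  · have h1 : ∀ᵐ y, DifferentiableAt ℝ ζ (x - y) :=
      (quasiMeasurePreserving_sub_left volume x).ae hζ.ae_differentiableAt
    filter_upwards [h1] with y hy
    have h2 : HasFDerivAt (fun a => ζ (a - y)) (fderiv ℝ ζ (x - y)) x :=
      (hasFDerivAt_comp_sub y).2 hy.hasFDerivAt
    exact h2.const_smul ((mollifier d n).normed volume y)

lemma contDiff_mollify (n : ℕ) {ζ : Rd d → ℝ} (hζ : Continuous ζ) : ContDiff ℝ ∞ (mollify n ζ) :=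
  (mollifier d n).hasCompactSupport_normed.contDiff_convolution_left _
    (mollifier d n).contDiff_normed hζ.locallyIntegrable

/-- Mollification keeps the sup and Lipschitz bounds, and its gradients, being mollified gradients,
converge almost everywhere. -/
lemma WeakDivAgainst.of_smooth {α : Rd d → ℝ} {Φ : Rd d → Rd d} (hα : Integrable α)
    (hΦ : Integrable Φ)
    (h : ∀ ζ : Rd d → ℝ, ContDiff ℝ ∞ ζ → HasCompactSupport ζ → WeakDivAgainst α Φ ζ)
    {ζ : Rd d → ℝ} {K : ℝ≥0} (hK : LipschitzWith K ζ) (hζ : HasCompactSupport ζ) :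
    WeakDivAgainst α Φ ζ := by
  obtain ⟨C, hC⟩ := hζ.exists_bound_of_continuous hK.continuous
  have hb : ∀ x, ‖fderiv ℝ ζ x‖ ≤ K := fun x => norm_fderiv_le_of_lipschitz ℝ hK
  have hli : LocallyIntegrable (fderiv ℝ ζ) := fun x =>
    ⟨Metric.ball x 1, Metric.ball_mem_nhds x one_pos, Measure.integrableOn_of_bounded
      measure_ball_lt_top.ne (measurable_fderiv ℝ ζ).aestronglyMeasurable (.of_forall hb)⟩
  refine weakDivAgainst_of_tendsto hα hΦ (ζs := fun n => mollify n ζ)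
    (fun n => norm_mollify_le n hC) (fun n => lipschitzWith_mollify n hK hC) (fun x =>
      ContDiffBump.convolution_tendsto_right_of_continuous (tendsto_mollifier_rOut d)
        hK.continuous x) ?_ (fun n => h _ (contDiff_mollify n hK.continuous)
          ((mollifier d n).hasCompactSupport_normed.convolution _ hζ))
  -- The factor `2` is the ratio `rOut / rIn` of `mollifier`; Lebesgue differentiation needs this
  -- ratio bounded.
  filter_upwards [ContDiffBump.ae_convolution_tendsto_right_of_locallyIntegrable (K := 2)
    (tendsto_mollifier_rOut d) (.of_forall fun n => le_rfl) hli] with x hx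
  refine ((LinearIsometryEquiv.continuous _).tendsto _).comp (hx.congr fun n => ?_)
  exact (fderiv_mollify n hK hC x).symm

lemma lipschitzWith_farCutoff (z₀ : Rd d) (j : ℕ) : LipschitzWith 1 (farCutoff z₀ j) := by
  refine LipschitzWith.of_dist_le_mul fun x y => ?_
  have h1 := abs_max_sub_max_le_abs (min 1 (dist x z₀ - j)) (min 1 (dist y z₀ - j)) 0
  have h2 := abs_min_sub_min_le_max (1 : ℝ) (dist x z₀ - j) 1 (dist y z₀ - j)
  simp only [sub_self, abs_zero, sub_sub_sub_cancel_right] at h2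
  rw [max_eq_right (abs_nonneg _)] at h2
  rw [farCutoff_apply, farCutoff_apply, Real.dist_eq, max_comm, max_comm 0, NNReal.coe_one, one_mul]
  exact h1.trans (h2.trans (abs_dist_sub_le x y z₀))

/-- The weak form of `div Φ = -α` extends from smooth compactly supported to bounded Lipschitz
test functions. -/
theorem WeakDivAgainst.of_bounded_lipschitz {α : Rd d → ℝ} {Φ : Rd d → Rd d} (hα : Integrable α)
    (hΦ : Integrable Φ)
    (h : ∀ ζ : Rd d → ℝ, ContDiff ℝ ∞ ζ → HasCompactSupport ζ → WeakDivAgainst α Φ ζ)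
    {ζ : Rd d → ℝ} {K : ℝ≥0} (hK : LipschitzWith K ζ) {C : ℝ} (hC : ∀ x, |ζ x| ≤ C) :
    WeakDivAgainst α Φ ζ := by
  have hC0 : 0 ≤ C := (abs_nonneg _).trans (hC 0)
  have hθ : ∀ (j : ℕ) (x : Rd d), |1 - farCutoff (0 : Rd d) j x| ≤ 1 := fun j x => by
    rw [abs_of_nonneg (sub_nonneg.2 (farCutoff_le_one _ _ _))]
    linarith [farCutoff_nonneg (0 : Rd d) j x]
  -- The product rule bounds the cut-off functions uniformly in `j`. Near any given point the cutoff
  -- factor is eventually `1`, so gradients are eventually unchanged.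
  have hlip : ∀ j : ℕ, LipschitzWith (K + C.toNNReal)
      (fun x => ζ x * (1 - farCutoff (0 : Rd d) j x)) := fun j =>
    LipschitzWith.of_dist_le_mul fun x y => by
      have h1 := hK.dist_le_mul x y
      have h2 := (lipschitzWith_farCutoff (0 : Rd d) j).dist_le_mul x y
      rw [Real.dist_eq] at h1 h2 ⊢
      rw [NNReal.coe_add, Real.coe_toNNReal C hC0]
      have h3 : ζ x * (1 - farCutoff (0 : Rd d) j x) - ζ y * (1 - farCutoff (0 : Rd d) j y)
        = (ζ x - ζ y) * (1 - farCutoff (0 : Rd d) j x)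
          - ζ y * (farCutoff (0 : Rd d) j x - farCutoff (0 : Rd d) j y) := by ring
      rw [h3]
      refine (abs_sub _ _).trans ?_
      rw [abs_mul, abs_mul, add_mul]
      refine add_le_add ?_ ?_
      · exact (mul_le_of_le_one_right (abs_nonneg _) (hθ j x)).trans h1
      · refine mul_le_mul (hC y) ?_ (abs_nonneg _) hC0
        simpa using h2
  refine weakDivAgainst_of_tendsto hα hΦ (C := C) (fun j x => ?_) hlip (fun x => ?_)
    (.of_forall fun x => ?_) (fun j => .of_smooth hα hΦ h (hlip j)
      (HasCompactSupport.intro (isCompact_closedBall 0 (j + 1)) fun z hz => ?_))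
  · rw [abs_mul]
    exact (mul_le_of_le_one_right (abs_nonneg _) (hθ j x)).trans (hC x)
  · simpa using ((tendsto_farCutoff 0 x).const_sub 1).const_mul (ζ x)
  · obtain ⟨N, hN⟩ := exists_nat_gt (dist x 0)
    refine tendsto_const_nhds.congr' ?_
    filter_upwards [eventually_ge_atTop N] with j hj
    refine (gradient_congr_of_eventuallyEq ?_).symm
    have h1 : ∀ᶠ y in 𝓝 x, dist y 0 < N :=
      (continuous_id.dist continuous_const).tendsto x |>.eventually_lt_const hN
    filter_upwards [h1] with y hy
    rw [farCutoff_eq_zero (hy.le.trans (by exact_mod_cast hj))]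
    simp
  · rw [farCutoff_eq_one (not_le.1 hz).le]; simp

end Extension

/-! ### Weak time derivatives -/

section Time

/-- The primitive of `ψ` based at `T` vanishes beyond the support of `ψ`, but not necessarily near
`0`. That is harmless, since tests may be nonzero at time `0`; a bump equal to `1` on `[-T, T]`
makes the support compact. -/
lemma exists_test_with_deriv {T : ℝ} (hT : 0 < T) {ψ : ℝ → ℝ} (hψ : ContDiff ℝ ∞ ψ)
    (hc : HasCompactSupport ψ) (hs : tsupport ψ ⊆ Ioo 0 T) :
    ∃ χ : ℝ → ℝ, ContDiff ℝ ∞ χ ∧ HasCompactSupport χ ∧ tsupport χ ⊆ Iio T ∧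
      ∀ t ∈ Ioo 0 T, deriv χ t = ψ t := by
  obtain ⟨T', hT', hψT'⟩ : ∃ T' < T, ∀ t, T' < t → ψ t = 0 := by
    rcases (tsupport ψ).eq_empty_or_nonempty with h | h
    · exact ⟨0, hT, fun t _ => image_eq_zero_of_notMem_tsupport (by simp [h])⟩
    · obtain ⟨T', h1, h2⟩ := hc.isCompact.exists_isGreatest h
      exact ⟨T', (hs h1).2, fun t ht => image_eq_zero_of_notMem_tsupport
        fun h3 => (h2 h3).not_gt ht⟩
  let P : ℝ → ℝ := fun t => ∫ s in T..t, ψ s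
  have hPd : ∀ t, HasDerivAt P (ψ t) t := fun t =>
    intervalIntegral.integral_hasDerivAt_right (hψ.continuous.intervalIntegrable _ _)
      (hψ.continuous.stronglyMeasurableAtFilter _ _) hψ.continuous.continuousAt
  have hP : ContDiff ℝ ∞ P := by
    rw [contDiff_infty_iff_deriv]
    refine ⟨fun t => (hPd t).differentiableAt, ?_⟩
    rwa [show deriv P = ψ from funext fun t => (hPd t).deriv]
  have hP0 : ∀ t, T' < t → P t = 0 := fun t ht => by
    refine intervalIntegral.integral_zero_ae (.of_forall fun s hs => hψT' s ?_)
    exact (lt_min hT' ht).trans hs.1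
  let b : ContDiffBump (0 : ℝ) := ⟨T, T + 1, hT, by linarith⟩
  refine ⟨fun t => P t * b t, hP.mul b.contDiff, b.hasCompactSupport.mul_left, ?_, fun t ht => ?_⟩
  · refine (closure_minimal (fun t ht => ?_) isClosed_Iic).trans (Iic_subset_Iio.2 hT')
    by_contra h
    exact ht (by simp [hP0 t (not_le.1 h)])
  · have h1 : (fun s => P s * b s) =ᶠ[𝓝 t] P := by
      filter_upwards [Ioo_mem_nhds ht.1 ht.2] with s hs
      rw [b.one_of_mem_closedBall, mul_one]
      simp only [Metric.mem_closedBall, dist_zero_right, Real.norm_eq_abs, abs_of_pos hs.1]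
      exact hs.2.le
    rw [h1.deriv_eq, (hPd t).deriv]

/-- A function whose weak derivative is integrable, with prescribed initial value, is a.e. the
corresponding primitive. -/
lemma ae_eq_primitive_of_weak {T : ℝ} (hT : 0 < T) {w g : ℝ → ℝ} {w₀ : ℝ}
    (hw : IntegrableOn w (Ioo 0 T)) (hg : IntegrableOn g (Ioo 0 T))
    (h : ∀ χ : ℝ → ℝ, ContDiff ℝ ∞ χ → HasCompactSupport χ → tsupport χ ⊆ Iio T →
      (∫ t in Ioo 0 T, (deriv χ t * w t + χ t * g t)) + χ 0 * w₀ = 0) :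
    ∀ᵐ t ∂(volume.restrict (Ioo 0 T)), w t = w₀ + ∫ s in 0..t, g s := by
  have hgI : IntervalIntegrable g volume 0 T :=
    (intervalIntegrable_iff_integrableOn_Ioo_of_le hT.le).2 hg
  let G : ℝ → ℝ := fun t => ∫ s in 0..t, g s
  have hGac : AbsolutelyContinuousOnInterval G 0 T :=
    hgI.absolutelyContinuousOnInterval_intervalIntegral left_mem_uIcc
  have hGc : ContinuousOn G (Icc 0 T) := by simpa [uIcc_of_le hT.le] using hGac.continuousOn
  have hGi : IntegrableOn G (Ioo 0 T) := (hGc.integrableOn_Icc).mono_set Ioo_subset_Icc_self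
  have hGd : ∀ᵐ t, t ∈ uIoc 0 T → deriv G t = g t := by
    filter_upwards [hgI.ae_hasDerivAt_integral] with t ht hmem
    exact (ht (uIoc_subset_uIcc hmem) 0 left_mem_uIcc).deriv
  have hR : IntegrableOn (fun t => w t - w₀ - G t) (Ioo 0 T) :=
    (hw.sub (integrableOn_const (by simp))).sub hGi
  -- Writing `ψ = χ'`, integration by parts against `G` and against the constant `w₀` turns the
  -- hypothesis for `χ` into `∫ ψ (w - w₀ - G) = 0`; the boundary terms use `χ T = 0` and `G 0 = 0`.
  have key : ∀ ψ : ℝ → ℝ, ContDiff ℝ ∞ ψ → HasCompactSupport ψ → tsupport ψ ⊆ Ioo 0 T →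
      ∫ t, ψ t • (Ioo 0 T).indicator (fun t => w t - w₀ - G t) t = 0 := fun ψ h1 h2 h3 => by
    obtain ⟨χ, hχ, hχc, hχs, hχd⟩ := exists_test_with_deriv hT h1 h2 h3
    have hχT : χ T = 0 := image_eq_zero_of_notMem_tsupport fun h => lt_irrefl T (hχs h)
    have hχ' : Continuous (deriv χ) := hχ.continuous_deriv (by simp)
    have hmul : ∀ {f : ℝ → ℝ} {p : ℝ → ℝ}, IntegrableOn f (Ioo 0 T) → Continuous p →
        IntegrableOn (fun t => p t * f t) (Ioo 0 T) := fun {f p} hf hp => by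
      have := (intervalIntegrable_iff_integrableOn_Ioo_of_le hT.le).2 hf
      exact (intervalIntegrable_iff_integrableOn_Ioo_of_le hT.le).1
        (this.continuousOn_mul hp.continuousOn)
    have e1 : ∫ t in Ioo 0 T, χ t * g t = -∫ t in Ioo 0 T, deriv χ t * G t := by
      have h4 := (hχ.contDiffOn.of_le (by simp)).absolutelyContinuousOnInterval (a := 0) (b := T)
        |>.integral_mul_deriv_eq_deriv_mul hGac
      rw [hχT, show G 0 = 0 from intervalIntegral.integral_same,
        intervalIntegral.integral_congr_ae (g := fun t => χ t * g t) (by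
          filter_upwards [hGd] with t ht hmem
          rw [ht hmem]), intervalIntegral.integral_of_le hT.le,
        intervalIntegral.integral_of_le hT.le, integral_Ioc_eq_integral_Ioo,
        integral_Ioc_eq_integral_Ioo] at h4
      simpa using h4
    have e2 : χ 0 * w₀ = -∫ t in Ioo 0 T, deriv χ t * w₀ := by
      have h4 := intervalIntegral.integral_deriv_eq_sub (f := χ) (a := 0) (b := T)
        (fun t _ => (hχ.differentiable (by simp)).differentiableAt) (hχ'.intervalIntegrable _ _)
      rw [intervalIntegral.integral_of_le hT.le, integral_Ioc_eq_integral_Ioo, hχT] at h4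
      rw [integral_mul_const, h4]; ring
    have e3 := h χ hχ hχc hχs
    rw [integral_add (hmul hw hχ') (hmul hg hχ.continuous), e1, e2] at e3
    have e4 : ∫ t in Ioo 0 T, deriv χ t * (w t - w₀ - G t) = 0 := by
      have e5 : ∀ t, deriv χ t * (w t - w₀ - G t)
          = deriv χ t * w t - deriv χ t * w₀ - deriv χ t * G t := fun t => by ring
      simp_rw [e5]
      have i1 : IntegrableOn (fun t => deriv χ t * w₀) (Ioo 0 T) :=
        hmul (integrableOn_const (by simp)) hχ'
      have i2 : IntegrableOn (fun t => deriv χ t * w t - deriv χ t * w₀) (Ioo 0 T) :=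
        (hmul hw hχ').sub i1
      rw [integral_sub i2 (hmul hGi hχ'), integral_sub (hmul hw hχ') i1]
      linarith
    refine Eq.trans ?_ e4
    rw [← integral_indicator measurableSet_Ioo]
    refine integral_congr_ae (.of_forall fun t => ?_)
    by_cases ht : t ∈ Ioo 0 T
    · simp [indicator_of_mem ht, hχd t ht]
    · simp [indicator_of_notMem ht]
  have h5 := isOpen_Ioo.ae_eq_zero_of_integral_contDiff_smul_eq_zero (μ := volume)
    (U := Ioo 0 T) (f := (Ioo 0 T).indicator fun t => w t - w₀ - G t)
    ((hR.integrable_indicator measurableSet_Ioo).locallyIntegrable.locallyIntegrableOn _) key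
  rw [ae_restrict_iff' measurableSet_Ioo]
  filter_upwards [h5] with t ht hmem
  have := ht hmem
  rw [indicator_of_mem hmem] at this
  linarith

end Time

/-! ### Weak gradients and the Laplacian -/

section Slices

variable {d : ℕ}

lemma laplacian_eq_sum_fderiv {ζ : Rd d → ℝ} (x : Rd d) (hζ : ContDiff ℝ ∞ ζ) :
    Laplacian.laplacian ζ x = ∑ i, fderiv ℝ (fun y => fderiv ℝ ζ y
      (EuclideanSpace.basisFun (Fin d) ℝ i)) x (EuclideanSpace.basisFun (Fin d) ℝ i) := by
  rw [InnerProductSpace.laplacian_eq_iteratedFDeriv_orthonormalBasis ζ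
    (EuclideanSpace.basisFun (Fin d) ℝ)]
  refine Finset.sum_congr rfl fun i _ => ?_
  have h1 : DifferentiableAt ℝ (fderiv ℝ ζ) x :=
    ((hζ.fderiv_right (m := ∞) (by simp)).differentiable (by simp)).differentiableAt
  rw [iteratedFDeriv_two_apply, fderiv_clm_apply h1 (differentiableAt_const _)]
  simp

lemma fderiv_eq_inner_gradient (ζ : Rd d → ℝ) (x v : Rd d) :
    fderiv ℝ ζ x v = inner ℝ (gradient ζ x) v := by
  rw [gradient, InnerProductSpace.toDual_symm_apply]

/-- Each partial derivative `∂ᵢζ` is an admissible test function for the weak gradient; the `i`-th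
components are then summed. -/
lemma HasWeakGradient.integral_mul_laplacian {f : Rd d → ℝ} {g : Rd d → Rd d}
    (h : HasWeakGradient f g) (hf : Integrable f) (hg : Integrable g) {ζ : Rd d → ℝ}
    (hζ : ContDiff ℝ ∞ ζ) (hc : HasCompactSupport ζ) :
    ∫ x, f x * Laplacian.laplacian ζ x = -∫ x, inner ℝ (gradient ζ x) (g x) := by
  set e := EuclideanSpace.basisFun (Fin d) ℝ
  let φ : Fin d → Rd d → ℝ := fun i y => fderiv ℝ ζ y (e i)
  have hφ : ∀ i, ContDiff ℝ ∞ (φ i) := fun i =>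
    (hζ.fderiv_right (by simp)).clm_apply contDiff_const
  have hφc : ∀ i, HasCompactSupport (φ i) := fun i => hc.fderiv_apply (𝕜 := ℝ) (e i)
  have h1 : ∀ i, Integrable fun x => f x * fderiv ℝ (φ i) x (e i) := fun i => by
    obtain ⟨C, hC⟩ := ((hφc i).fderiv_apply (𝕜 := ℝ) (e i)).exists_bound_of_continuous
      (((hφ i).continuous_fderiv (by simp)).clm_apply continuous_const)
    exact hf.mul_bdd (c := C) (((hφ i).continuous_fderiv (by simp)).clm_apply
      continuous_const).aestronglyMeasurable (.of_forall hC)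
  have h2 : ∀ i, Integrable fun x => φ i x • g x := fun i => by
    obtain ⟨C, hC⟩ := (hφc i).exists_bound_of_continuous (hφ i).continuous
    exact hg.bdd_smul C (hφ i).continuous.aestronglyMeasurable (.of_forall hC)
  have h3 : ∀ i, Integrable fun x => f x • gradient (φ i) x := fun i => by
    obtain ⟨K, hK⟩ := ContDiff.lipschitzWith_of_hasCompactSupport (hφc i) (hφ i) (by simp)
    exact hf.smul_bdd K (measurable_gradient _).aestronglyMeasurable
      (.of_forall (norm_gradient_le_of_lipschitz hK))
  have h4 : ∀ i, ∫ x, f x * fderiv ℝ (φ i) x (e i) = -∫ x, φ i x * inner ℝ (e i) (g x) := fun i => by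
    have h5 := congrArg (fun v => inner ℝ (e i) v) (h (φ i) (hφ i) (hφc i))
    simp only [inner_neg_right] at h5
    rw [← integral_inner (h3 i), ← integral_inner (h2 i)] at h5
    simp_rw [inner_smul_right] at h5
    rw [← h5]
    simp_rw [fderiv_eq_inner_gradient, real_inner_comm (e i)]
  simp_rw [fun x => laplacian_eq_sum_fderiv x hζ, Finset.mul_sum]
  rw [integral_finsetSum _ fun i _ => h1 i]
  simp_rw [h4]
  rw [Finset.sum_neg_distrib, ← integral_finsetSum]
  · congr 2
    ext x
    simp only [φ, fderiv_eq_inner_gradient]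
    exact e.sum_inner_mul_inner _ _
  · intro i _
    have := (h2 i).const_inner (𝕜 := ℝ) (e i)
    simpa only [inner_smul_right] using this

end Slices

/-! ### Time evolution against fixed test functions, and accumulated fluxes -/

section Evolution

variable {d : ℕ} {T : ℝ}

lemma integrable_spaceTime_inner_gradient {V : ℝ → Rd d → Rd d}
    (hV : Integrable (Function.uncurry V) (spaceTime d T)) {ζ : Rd d → ℝ} {K : ℝ≥0}
    (hζ : LipschitzWith K ζ) :
    Integrable (fun z : ℝ × Rd d => inner ℝ (gradient ζ z.2) (V z.1 z.2)) (spaceTime d T) := by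
  refine (hV.norm.const_mul K).mono' (((measurable_gradient ζ).comp
    measurable_snd).aestronglyMeasurable.inner hV.aestronglyMeasurable)
    (.of_forall fun x => (norm_inner_le_norm _ _).trans ?_)
  exact mul_le_mul_of_nonneg_right (norm_gradient_le_of_lipschitz hζ _) (norm_nonneg _)

lemma laplacian_const_mul (a : ℝ) {ζ : Rd d → ℝ} (hζ : ContDiff ℝ ∞ ζ) (x : Rd d) :
    Laplacian.laplacian (fun y => a * ζ y) x = a * Laplacian.laplacian ζ x :=
  InnerProductSpace.laplacian_smul a (hζ.contDiffAt.of_le (WithTop.coe_le_coe.2 le_top))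

lemma gradient_const_mul (a : ℝ) {ζ : Rd d → ℝ} (hζ : ContDiff ℝ ∞ ζ) (x : Rd d) :
    gradient (fun y => a * ζ y) x = a • gradient ζ x := by
  have h : DifferentiableAt ℝ ζ x := (hζ.differentiable (by simp)).differentiableAt
  rw [gradient, fderiv_const_mul h, map_smul]; rfl

lemma continuous_laplacian {ζ : Rd d → ℝ} (hζ : ContDiff ℝ ∞ ζ) :
    Continuous (Laplacian.laplacian ζ) := by
  rw [InnerProductSpace.laplacian_eq_iteratedFDeriv_stdOrthonormalBasis]
  have := hζ.continuous_iteratedFDeriv (m := 2) (WithTop.coe_le_coe.2 le_top)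
  fun_prop

lemma exists_bound_laplacian {ζ : Rd d → ℝ} (hζ : ContDiff ℝ ∞ ζ) (hc : HasCompactSupport ζ) :
    ∃ C, ∀ x, ‖Laplacian.laplacian ζ x‖ ≤ C := by
  refine HasCompactSupport.exists_bound_of_continuous (HasCompactSupport.intro hc.isCompact
    fun x hx => ?_) (continuous_laplacian hζ)
  have h0 : ζ =ᶠ[𝓝 x] fun _ => 0 := notMem_tsupport_iff_eventuallyEq.1 hx
  have h1 := InnerProductSpace.laplacian_congr_nhds h0
  rw [h1.self_of_nhds]; simp

/-- The time evolution of a solution, tested against a fixed test function in space. -/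
lemma IsDistributionalSolution.ae_integral_eq {T : ℝ} (hT : 0 < T) {u : ℝ → Rd d → Rd d} {κ : ℝ}
    {θ₀ : Rd d → ℝ} {θ : ℝ → Rd d → ℝ} {g : ℝ → Rd d → Rd d}
    (hsol : IsDistributionalSolution T u κ θ₀ θ) (hW : MemL1W11 T θ g)
    (hflux : Integrable (fun z : ℝ × Rd d => θ z.1 z.2 • u z.1 z.2) (spaceTime d T))
    {ζ : Rd d → ℝ} (hζ : ContDiff ℝ ∞ ζ) (hc : HasCompactSupport ζ) :
    ∀ᵐ t ∂(volume.restrict (Ioo 0 T)), ∫ x, ζ x * θ t x = (∫ x, ζ x * θ₀ x) +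
      ∫ s in 0..t, ∫ x, inner ℝ (gradient ζ x) (θ s x • u s x - κ • g s x) := by
  obtain ⟨hθ, hg, hgrad⟩ := hW
  obtain ⟨K, hK⟩ := ContDiff.lipschitzWith_of_hasCompactSupport hc hζ (by simp)
  obtain ⟨C, hC⟩ := hc.exists_bound_of_continuous hζ.continuous
  obtain ⟨B, hB⟩ := exists_bound_laplacian hζ hc
  have hLc := continuous_laplacian hζ
  -- integrability of the pieces
  have i1 : Integrable (fun z : ℝ × Rd d => ζ z.2 * θ z.1 z.2) (spaceTime d T) :=
    hθ.bdd_mul (c := C) (hζ.continuous.comp continuous_snd).aestronglyMeasurable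
      (.of_forall fun z => hC _)
  have i2 : Integrable (fun z : ℝ × Rd d => θ z.1 z.2 * Laplacian.laplacian ζ z.2)
      (spaceTime d T) :=
    hθ.mul_bdd (c := B) (hLc.comp continuous_snd).aestronglyMeasurable (.of_forall fun z => hB _)
  have i3 : Integrable (fun z : ℝ × Rd d => inner ℝ (gradient ζ z.2) (θ z.1 z.2 • u z.1 z.2))
      (spaceTime d T) :=
    integrable_spaceTime_inner_gradient (V := fun s x => θ s x • u s x) hflux hK
  have i4 : Integrable (fun z : ℝ × Rd d => inner ℝ (gradient ζ z.2) (g z.1 z.2))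
      (spaceTime d T) := integrable_spaceTime_inner_gradient hg hK
  let w : ℝ → ℝ := fun t => ∫ x, ζ x * θ t x
  let G : ℝ → ℝ := fun t => ∫ x, inner ℝ (gradient ζ x) (θ t x • u t x - κ • g t x)
  have hw : IntegrableOn w (Ioo 0 T) := i1.integral_prod_left
  have hGint : IntegrableOn G (Ioo 0 T) := by
    have := (i3.sub (i4.const_mul κ)).integral_prod_left
    refine this.congr (.of_forall fun t => integral_congr_ae (.of_forall fun x => ?_))
    simp [inner_sub_right, inner_smul_right]
  -- Product tests `χ(t) ζ(x)` reduce the equation to the weak form of `w' = G` with initial value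
  -- `∫ ζ θ₀`.
  refine ae_eq_primitive_of_weak hT hw hGint fun χ hχ hχc hχs => ?_
  have hχ' : Continuous (deriv χ) := hχ.continuous_deriv (by simp)
  obtain ⟨A, hA⟩ := hχc.exists_bound_of_continuous hχ.continuous
  obtain ⟨A', hA'⟩ := (hχc.deriv).exists_bound_of_continuous hχ'
  have htest : IsTestFunction T fun z : ℝ × Rd d => χ z.1 * ζ z.2 := by
    have hsub : (tsupport fun z : ℝ × Rd d => χ z.1 * ζ z.2) ⊆ tsupport χ ×ˢ tsupport ζ := by
      refine closure_minimal (fun z hz => ?_) ((isClosed_tsupport _).prod (isClosed_tsupport _))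
      exact ⟨subset_tsupport _ (left_ne_zero_of_mul hz), subset_tsupport _ (right_ne_zero_of_mul hz)⟩
    refine ⟨(hχ.comp contDiff_fst).mul (hζ.comp contDiff_snd),
      (hχc.isCompact.prod hc.isCompact).of_isClosed_subset (isClosed_tsupport _) hsub,
      fun z hz => hχs (hsub hz).1⟩
  have key := hsol.2 _ htest
  have hint : ∀ z : ℝ × Rd d, θ z.1 z.2 *
      (deriv (fun s => χ s * ζ z.2) z.1
        + inner ℝ (u z.1 z.2) (gradient (fun y => χ z.1 * ζ y) z.2)
        + κ * Laplacian.laplacian (fun y => χ z.1 * ζ y) z.2)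
      = deriv χ z.1 * (ζ z.2 * θ z.1 z.2) + χ z.1 *
        (inner ℝ (gradient ζ z.2) (θ z.1 z.2 • u z.1 z.2)
          + κ * (θ z.1 z.2 * Laplacian.laplacian ζ z.2)) := fun z => by
    rw [deriv_mul_const (hχ.differentiable (by simp)).differentiableAt, gradient_const_mul _ hζ,
      laplacian_const_mul _ hζ, inner_smul_right, inner_smul_right, real_inner_comm]
    ring
  simp only [hint] at key
  have i5 : Integrable (fun z : ℝ × Rd d => deriv χ z.1 * (ζ z.2 * θ z.1 z.2)) (spaceTime d T) :=
    i1.bdd_mul (c := A') (hχ'.comp continuous_fst).aestronglyMeasurable (.of_forall fun z => hA' _)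
  have i6 : Integrable (fun z : ℝ × Rd d => χ z.1 *
        (inner ℝ (gradient ζ z.2) (θ z.1 z.2 • u z.1 z.2)
          + κ * (θ z.1 z.2 * Laplacian.laplacian ζ z.2))) (spaceTime d T) :=
    (i3.add (i2.const_mul κ)).bdd_mul (c := A) (hχ.continuous.comp
      continuous_fst).aestronglyMeasurable (.of_forall fun z => hA _)
  rw [integral_add i5 i6, spaceTime, integral_prod _ i5, integral_prod _ i6] at key
  rw [integral_add (f := fun t => deriv χ t * w t) (g := fun t => χ t * G t)
    (hw.bdd_mul (c := A') hχ'.aestronglyMeasurable (.of_forall hA'))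
    (hGint.bdd_mul (c := A) hχ.continuous.aestronglyMeasurable (.of_forall hA))]
  refine Eq.trans ?_ key
  congr 1
  · congr 1
    · refine integral_congr_ae (.of_forall fun t => ?_)
      exact (integral_const_mul _ _).symm
    · refine integral_congr_ae ?_
      filter_upwards [hgrad, hθ.prod_right_ae, hg.prod_right_ae, i2.prod_right_ae, i3.prod_right_ae,
        i4.prod_right_ae] with t h1 h2 h3 h4 h5 h6
      have h7 := h1.integral_mul_laplacian h2 h3 hζ hc
      change χ t * G t = ∫ y, χ t * (inner ℝ (gradient ζ y) (θ t y • u t y) +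
        κ * (θ t y * Laplacian.laplacian ζ y))
      rw [integral_const_mul, integral_add h5 (h4.const_mul κ), integral_const_mul, h7]
      congr 1
      simp only [G, inner_sub_right, inner_smul_right (gradient ζ _) (g t _)]
      rw [integral_sub h5 (h6.const_mul κ), integral_const_mul]
      ring
  · rw [← integral_const_mul]
    exact integral_congr_ae (.of_forall fun x => by ring)

/-- The flux accumulated between two times. -/
noncomputable def fluxBetween (V : ℝ → Rd d → Rd d) (a b : ℝ) (x : Rd d) : Rd d :=
  ∫ r in a..b, V r x

lemma integrable_restrict_Ioc_spaceTime {V : ℝ → Rd d → Rd d}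
    (hV : Integrable (Function.uncurry V) (spaceTime d T)) {a b : ℝ} (ha : 0 ≤ a) (hb : b ≤ T) :
    Integrable (Function.uncurry V) ((volume.restrict (Ioc a b)).prod volume) := by
  refine hV.mono_measure ?_
  rw [spaceTime, restrict_Ioo_eq_restrict_Ioc]
  exact Measure.prod_mono (Measure.restrict_mono (Ioc_subset_Ioc ha hb) le_rfl) le_rfl

lemma integrable_fluxBetween {V : ℝ → Rd d → Rd d}
    (hV : Integrable (Function.uncurry V) (spaceTime d T)) {a b : ℝ}
    (ha : a ∈ Icc 0 T) (hb : b ∈ Icc 0 T) : Integrable (fluxBetween V a b) := by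
  wlog hab : a ≤ b generalizing a b
  · have := this hb ha (not_le.1 hab).le
    refine this.neg.congr (.of_forall fun x => ?_)
    simp only [Pi.neg_apply, fluxBetween]
    rw [intervalIntegral.integral_symm a b]; simp
  · have h1 := (integrable_restrict_Ioc_spaceTime hV ha.1 hb.2).integral_prod_right
    refine h1.congr (.of_forall fun x => ?_)
    exact (intervalIntegral.integral_of_le hab).symm

lemma integral_inner_fluxBetween {V : ℝ → Rd d → Rd d}
    (hV : Integrable (Function.uncurry V) (spaceTime d T)) {a b : ℝ}
    (ha : a ∈ Icc 0 T) (hb : b ∈ Icc 0 T) {ζ : Rd d → ℝ} {K : ℝ≥0} (hζ : LipschitzWith K ζ) :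
    ∫ x, inner ℝ (gradient ζ x) (fluxBetween V a b x)
      = ∫ r in a..b, ∫ x, inner ℝ (gradient ζ x) (V r x) := by
  wlog hab : a ≤ b generalizing a b
  · have := this hb ha (not_le.1 hab).le
    rw [intervalIntegral.integral_symm, ← this, ← integral_neg]
    refine integral_congr_ae (.of_forall fun x => ?_)
    simp only [fluxBetween]
    rw [intervalIntegral.integral_symm, inner_neg_right]
  · have hV' := integrable_restrict_Ioc_spaceTime hV ha.1 hb.2
    have h1 : Integrable (fun z : ℝ × Rd d => inner ℝ (gradient ζ z.2) (V z.1 z.2))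
        ((volume.restrict (Ioc a b)).prod volume) := by
      refine (hV'.norm.const_mul K).mono' (((measurable_gradient ζ).comp
        measurable_snd).aestronglyMeasurable.inner hV'.aestronglyMeasurable)
        (.of_forall fun x => (norm_inner_le_norm _ _).trans ?_)
      exact mul_le_mul_of_nonneg_right (norm_gradient_le_of_lipschitz hζ _) (norm_nonneg _)
    rw [intervalIntegral.integral_of_le hab, integral_integral_swap h1]
    refine integral_congr_ae ?_
    filter_upwards [hV'.prod_left_ae] with x hx
    rw [fluxBetween, intervalIntegral.integral_of_le hab]
    exact (integral_inner hx _).symm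

end Evolution

/-! ### One null set of times for all test functions -/

section Separability

variable {d : ℕ}

/-- Smooth functions supported in a ball, together with their gradients. -/
def smoothJets (d R : ℕ) : Set C(Rd d, ℝ × Rd d) :=
  {f | ∃ ζ : Rd d → ℝ, ContDiff ℝ ∞ ζ ∧ tsupport ζ ⊆ Metric.closedBall 0 R ∧
    ∀ x, f x = (ζ x, gradient ζ x)}

lemma gradient_eq_zero_of_notMem_tsupport {ζ : Rd d → ℝ} {x : Rd d} (h : x ∉ tsupport ζ) :
    gradient ζ x = 0 := by
  rw [gradient_congr_of_eventuallyEq (notMem_tsupport_iff_eventuallyEq.1 h)]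
  simp [gradient]

lemma continuous_gradient {ζ : Rd d → ℝ} (hζ : ContDiff ℝ ∞ ζ) : Continuous (gradient ζ) :=
  (LinearIsometryEquiv.continuous _).comp (hζ.continuous_fderiv (by simp))

/-- All supports lie in one ball, so local integrability of `α` suffices for dominated convergence;
this matters because initial data are only locally integrable. -/
lemma WeakDivAgainst.of_tendsto_smoothJets {α : Rd d → ℝ} {Φ : Rd d → Rd d}
    (hα : LocallyIntegrable α) (hΦ : Integrable Φ) {R : ℕ} {ζs : ℕ → Rd d → ℝ} {ζ : Rd d → ℝ}
    (hζs : ∀ n, ContDiff ℝ ∞ (ζs n)) (hζ : ContDiff ℝ ∞ ζ)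
    (hs : ∀ n, tsupport (ζs n) ⊆ Metric.closedBall 0 R)
    (h0 : TendstoUniformlyOn (fun n x => (ζs n x, gradient (ζs n) x)) (fun x => (ζ x, gradient ζ x))
      atTop (Metric.closedBall 0 R))
    (hlim : ∀ x, Tendsto (fun n => (ζs n x, gradient (ζs n) x)) atTop (𝓝 (ζ x, gradient ζ x)))
    (h : ∀ n, WeakDivAgainst α Φ (ζs n)) : WeakDivAgainst α Φ ζ := by
  have hK : IsCompact (Metric.closedBall (0 : Rd d) R) := isCompact_closedBall _ _
  obtain ⟨C, hC⟩ := hK.exists_bound_of_continuousOn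
    (hζ.continuous.prodMk (continuous_gradient hζ)).continuousOn
  have hev : ∀ᶠ n in atTop, ∀ x, ‖(ζs n x, gradient (ζs n) x)‖ ≤
      (Metric.closedBall (0 : Rd d) R).indicator (fun _ => C + 1) x := by
    filter_upwards [Metric.tendstoUniformlyOn_iff.1 h0 1 one_pos] with n hn x
    by_cases hx : x ∈ Metric.closedBall (0 : Rd d) R
    · rw [indicator_of_mem hx]
      have h1 := (hn x hx).le
      rw [dist_comm, dist_eq_norm] at h1
      have h2 := norm_le_norm_add_norm_sub (ζ x, gradient ζ x) (ζs n x, gradient (ζs n) x)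
      rw [norm_sub_rev] at h2
      linarith [hC x hx]
    · rw [indicator_of_notMem hx, image_eq_zero_of_notMem_tsupport fun h => hx (hs n h),
        gradient_eq_zero_of_notMem_tsupport fun h => hx (hs n h)]
      simp
  have h1 : Tendsto (fun n => ∫ x, ζs n x * α x) atTop (𝓝 (∫ x, ζ x * α x)) := by
    refine tendsto_integral_filter_of_dominated_convergence
      (fun x => (Metric.closedBall (0 : Rd d) R).indicator (fun x => (C + 1) * |α x|) x)
      (.of_forall fun n => (hζs n).continuous.aestronglyMeasurable.mul hα.aestronglyMeasurable)
      ?_ ?_ (.of_forall fun x => ((continuous_fst.tendsto _).comp (hlim x)).mul_const _)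
    · filter_upwards [hev] with n hn
      refine .of_forall fun x => ?_
      have h2 := (norm_fst_le _).trans (hn x)
      rw [norm_mul, indicator_mul_left]
      exact mul_le_mul_of_nonneg_right h2 (abs_nonneg _)
    · rw [integrable_indicator_iff hK.measurableSet]
      exact ((hα.integrableOn_isCompact hK).abs).const_mul _
  have h2 : Tendsto (fun n => ∫ x, inner ℝ (gradient (ζs n) x) (Φ x)) atTop
      (𝓝 (∫ x, inner ℝ (gradient ζ x) (Φ x))) := by
    refine tendsto_integral_filter_of_dominated_convergence (fun x => |C + 1| * ‖Φ x‖)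
      (.of_forall fun n => (continuous_gradient (hζs n)).aestronglyMeasurable.inner
        hΦ.aestronglyMeasurable)
      ?_ (hΦ.norm.const_mul _)
      (.of_forall fun x => ((continuous_snd.tendsto _).comp (hlim x)).inner tendsto_const_nhds)
    filter_upwards [hev] with n hn
    refine .of_forall fun x => (norm_inner_le_norm _ _).trans ?_
    refine mul_le_mul_of_nonneg_right (((norm_snd_le _).trans (hn x)).trans ?_) (norm_nonneg _)
    by_cases hx : x ∈ Metric.closedBall (0 : Rd d) R
    · rw [indicator_of_mem hx]; exact le_abs_self _
    · rw [indicator_of_notMem hx]; exact abs_nonneg _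
  exact tendsto_nhds_unique (h1.congr h) h2

/-- An almost everywhere statement for each smooth test function holds almost everywhere for all
smooth test functions. -/
lemma ae_forall_weakDivAgainst {ν : Measure ℝ} {α : ℝ → Rd d → ℝ} {Φ : ℝ → Rd d → Rd d}
    (hα : ∀ᵐ t ∂ν, LocallyIntegrable (α t)) (hΦ : ∀ᵐ t ∂ν, Integrable (Φ t))
    (h : ∀ ζ : Rd d → ℝ, ContDiff ℝ ∞ ζ → HasCompactSupport ζ →
      ∀ᵐ t ∂ν, WeakDivAgainst (α t) (Φ t) ζ) :
    ∀ᵐ t ∂ν, ∀ ζ : Rd d → ℝ, ContDiff ℝ ∞ ζ → HasCompactSupport ζ →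
      WeakDivAgainst (α t) (Φ t) ζ := by
  have hch : ∀ R : ℕ, ∀ f : smoothJets d R, ∀ᵐ t ∂ν, WeakDivAgainst (α t) (Φ t) fun x => (f.1 x).1 :=
    fun R f => by
      obtain ⟨ζ, h1, h2, h3⟩ := f.2
      simp_rw [h3]
      exact h ζ h1 ((isCompact_closedBall 0 (R : ℝ)).of_isClosed_subset (isClosed_tsupport _) h2)
  -- The compact-open topology on pairs `(ζ, ∇ζ)` is separable, also on subsets, and its convergence
  -- is locally uniform convergence of functions and gradients. Countably many tests therefore
  -- suffice.
  choose D hDc hDd using fun R : ℕ => TopologicalSpace.exists_countable_dense (smoothJets d R)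
  have hall : ∀ᵐ t ∂ν, ∀ R : ℕ, ∀ f ∈ D R, WeakDivAgainst (α t) (Φ t) fun x => (f.1 x).1 := by
    rw [ae_all_iff]
    exact fun R => (ae_ball_iff (hDc R)).2 fun f _ => hch R f
  filter_upwards [hall, hα, hΦ] with t ht hαt hΦt ζ hζ hc
  obtain ⟨r, hr⟩ := hc.isCompact.isBounded.subset_closedBall 0
  obtain ⟨R, hR⟩ := exists_nat_ge r
  have hζR : tsupport ζ ⊆ Metric.closedBall 0 R := hr.trans (Metric.closedBall_subset_closedBall hR)
  let f : smoothJets d R := ⟨⟨fun x => (ζ x, gradient ζ x),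
    hζ.continuous.prodMk (continuous_gradient hζ)⟩, ζ, hζ, hζR, fun _ => rfl⟩
  obtain ⟨fs, hfs, hlim⟩ := mem_closure_iff_seq_limit.1 (hDd R f)
  have hlim' : Tendsto (fun n => (fs n).1) atTop (𝓝 f.1) :=
    (continuous_subtype_val.tendsto f).comp hlim
  choose ζs h1 h2 h3 using fun n => (fs n).2
  refine WeakDivAgainst.of_tendsto_smoothJets hαt hΦt (R := R) h1 hζ h2 ?_ (fun x => ?_) fun n => ?_
  · have := ContinuousMap.tendsto_iff_forall_isCompact_tendstoUniformlyOn.1 hlim' _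
      (isCompact_closedBall 0 (R : ℝ))
    exact this.congr (.of_forall fun n x _ => h3 n x)
  · have := ((ContinuousEvalConst.continuous_eval_const x).tendsto f.1).comp hlim'
    exact this.congr fun n => h3 n x
  · have := ht R (fs n) (hfs n)
    simpa only [h3] using this

end Separability

/-! ### The equation integrated in time -/

section Difference

variable {d : ℕ} {T : ℝ}

lemma IsDistributionalSolution.locallyIntegrable_initial {u : ℝ → Rd d → Rd d} {κ : ℝ}
    {θ₀ : Rd d → ℝ} {θ : ℝ → Rd d → ℝ} (hsol : IsDistributionalSolution T u κ θ₀ θ) :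
    LocallyIntegrable θ₀ := by
  obtain ⟨⟨p, q, hpq, -, h, -⟩, -⟩ := hsol
  have hq : 1 ≤ q := by
    have : q⁻¹ ≤ 1 := le_add_self.trans hpq
    rwa [ENNReal.inv_le_one] at this
  rw [locallyIntegrable_iff]
  intro K hK
  have : IsFiniteMeasure (volume.restrict K) := ⟨by simpa using hK.measure_lt_top⟩
  exact (h K hK).integrable hq

/-- For almost every time, the difference of a solution and its initial datum is the divergence of
the accumulated flux. -/
lemma IsDistributionalSolution.ae_weakDiv (hT : 0 < T) {u : ℝ → Rd d → Rd d} {κ : ℝ}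
    {θ₀ : Rd d → ℝ} {θ : ℝ → Rd d → ℝ} {g : ℝ → Rd d → Rd d}
    (hsol : IsDistributionalSolution T u κ θ₀ θ) (hW : MemL1W11 T θ g)
    (hflux : Integrable (fun z : ℝ × Rd d => θ z.1 z.2 • u z.1 z.2) (spaceTime d T)) :
    ∀ᵐ t ∂(volume.restrict (Ioo 0 T)), ∀ ζ : Rd d → ℝ, ContDiff ℝ ∞ ζ → HasCompactSupport ζ →
      WeakDivAgainst (fun x => θ t x - θ₀ x)
        (fluxBetween (fun s x => θ s x • u s x - κ • g s x) 0 t) ζ := by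
  have hV : Integrable (Function.uncurry fun s x => θ s x • u s x - κ • g s x) (spaceTime d T) :=
    hflux.sub (hW.2.1.smul κ)
  have hθ₀ := hsol.locallyIntegrable_initial
  have hmem : ∀ᵐ t ∂(volume.restrict (Ioo 0 T)), t ∈ Ioo 0 T := ae_restrict_mem measurableSet_Ioo
  refine ae_forall_weakDivAgainst (α := fun t x => θ t x - θ₀ x) ?_ ?_ fun ζ hζ hc => ?_
  · filter_upwards [hW.1.prod_right_ae] with t ht
    exact ht.locallyIntegrable.sub hθ₀
  · filter_upwards [hmem] with t ht
    exact integrable_fluxBetween hV ⟨le_rfl, hT.le⟩ (Ioo_subset_Icc_self ht)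
  · obtain ⟨K, hK⟩ := ContDiff.lipschitzWith_of_hasCompactSupport hc hζ (by simp)
    obtain ⟨C, hC⟩ := hc.exists_bound_of_continuous hζ.continuous
    filter_upwards [hsol.ae_integral_eq hT hW hflux hζ hc, hmem, hW.1.prod_right_ae] with t h1 h2 h3
    rw [WeakDivAgainst, integral_inner_fluxBetween hV ⟨le_rfl, hT.le⟩ (Ioo_subset_Icc_self h2) hK]
    simp_rw [mul_sub]
    have h4 : Integrable (θ t) := h3
    rw [integral_sub (integrable_mul_of_bounded h4 hζ.continuous hC), h1]
    · ring
    · exact hθ₀.integrable_smul_left_of_hasCompactSupport hζ.continuous hc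

end Difference

/-! ### Functions dominated by the increments of an absolutely continuous function -/

section Modulus

/-- A function on a set whose increments are bounded by those of `A` extends to the line, as a
`1`-Lipschitz function of `A`. -/
lemma exists_extension_of_increment_le {I : Set ℝ} {E A : ℝ → ℝ}
    (h : ∀ s ∈ I, ∀ t ∈ I, |E t - E s| ≤ |A t - A s|) :
    ∃ D : ℝ → ℝ, (∀ t ∈ I, D t = E t) ∧ ∀ s t, |D t - D s| ≤ |A t - A s| := by
  -- Where `A` takes equal values, so does `E`. Hence `E = f ∘ A` with `f` `1`-Lipschitz on `A ''
  -- I`, and only `f` needs extending.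
  have hinv : ∀ t ∈ I, Function.invFunOn A I (A t) ∈ I ∧ A (Function.invFunOn A I (A t)) = A t :=
    fun t ht => ⟨Function.invFunOn_mem ⟨t, ht, rfl⟩, Function.invFunOn_eq ⟨t, ht, rfl⟩⟩
  have hlip : LipschitzOnWith 1 (E ∘ Function.invFunOn A I) (A '' I) := by
    refine LipschitzOnWith.of_dist_le_mul ?_
    rintro _ ⟨s, hs, rfl⟩ _ ⟨t, ht, rfl⟩
    have := h _ (hinv t ht).1 _ (hinv s hs).1
    rw [(hinv t ht).2, (hinv s hs).2] at this
    simpa [Real.dist_eq] using this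
  obtain ⟨f, hf, hfe⟩ := hlip.extend_real
  refine ⟨f ∘ A, fun t ht => ?_, fun s t => ?_⟩
  · have h1 := h _ ht _ (hinv t ht).1
    rw [(hinv t ht).2, sub_self, abs_zero] at h1
    rw [Function.comp_apply, ← hfe ⟨t, ht, rfl⟩]
    exact sub_eq_zero.1 (abs_nonpos_iff.1 h1)
  · simpa [Real.dist_eq] using hf.dist_le_mul (A t) (A s)

lemma absolutelyContinuousOnInterval_of_increment_le {D A : ℝ → ℝ} {a b : ℝ}
    (hA : AbsolutelyContinuousOnInterval A a b) (h : ∀ s t, |D t - D s| ≤ |A t - A s|) :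
    AbsolutelyContinuousOnInterval D a b := by
  rw [absolutelyContinuousOnInterval_iff] at hA ⊢
  intro ε hε
  obtain ⟨δ, hδ, hA⟩ := hA ε hε
  refine ⟨δ, hδ, fun E hE hlen => (Finset.sum_le_sum fun i _ => ?_).trans_lt (hA E hE hlen)⟩
  rw [Real.dist_eq, Real.dist_eq]
  exact h _ _

end Modulus

/-! ### Transport distances along a flux -/

section Flow

variable {d : ℕ} {T : ℝ} {c : ℝ → ℝ}

/-- On the set of times `I`, the difference of the integrable densities `m₁` and `m₂` evolves by
the flux `V`. -/
structure EvolvesBy (T : ℝ) (I : Set ℝ) (m₁ m₂ : ℝ → Rd d → ℝ) (V : ℝ → Rd d → Rd d) : Prop where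
  subset : I ⊆ Icc 0 T
  left : ∀ t ∈ I, Integrable (m₁ t)
  right : ∀ t ∈ I, Integrable (m₂ t)
  flux : Integrable (Function.uncurry V) (spaceTime d T)
  weakDiv : ∀ s ∈ I, ∀ t ∈ I, ∀ ζ : Rd d → ℝ, ContDiff ℝ ∞ ζ → HasCompactSupport ζ →
    WeakDivAgainst (fun x => (m₁ t x - m₂ t x) - (m₁ s x - m₂ s x)) (fluxBetween V s t) ζ

/-- The total flux at each time. -/
noncomputable def fluxMass (T : ℝ) (V : ℝ → Rd d → Rd d) : ℝ → ℝ :=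
  (Ioo 0 T).indicator fun r => ∫ x, ‖V r x‖

lemma integrable_fluxMass {V : ℝ → Rd d → Rd d}
    (hV : Integrable (Function.uncurry V) (spaceTime d T)) : Integrable (fluxMass T V) := by
  rw [fluxMass, integrable_indicator_iff measurableSet_Ioo]
  exact hV.norm.integral_prod_left

lemma intervalIntegrable_inner_gradient {V : ℝ → Rd d → Rd d}
    (hV : Integrable (Function.uncurry V) (spaceTime d T)) {a b : ℝ}
    (ha : a ∈ Icc 0 T) (hb : b ∈ Icc 0 T) {ζ : Rd d → ℝ} {K : ℝ≥0} (hζ : LipschitzWith K ζ) :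
    IntervalIntegrable (fun r => ∫ x, inner ℝ (gradient ζ x) (V r x)) volume a b := by
  have h1 : IntegrableOn (fun r => ∫ x, inner ℝ (gradient ζ x) (V r x)) (Ioo 0 T) :=
    (integrable_spaceTime_inner_gradient hV hζ).integral_prod_left
  have h2 := (integrableOn_Icc_iff_integrableOn_Ioo (by simp) (by simp)).2 h1
  rw [intervalIntegrable_iff']
  exact h2.mono_set (uIcc_subset_Icc ha hb)

lemma abs_integral_inner_fluxBetween_le {V : ℝ → Rd d → Rd d}
    (hV : Integrable (Function.uncurry V) (spaceTime d T)) {a b : ℝ}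
    (ha : a ∈ Icc 0 T) (hb : b ∈ Icc 0 T) {ζ : Rd d → ℝ} {K : ℝ≥0} (hζ : LipschitzWith K ζ) :
    |∫ x, inner ℝ (gradient ζ x) (fluxBetween V a b x)| ≤
      |∫ r in a..b, K * fluxMass T V r| := by
  rw [integral_inner_fluxBetween hV ha hb hζ]
  refine intervalIntegral.norm_integral_le_abs_of_norm_le (f := fun r => ∫ x,
    inner ℝ (gradient ζ x) (V r x)) ?_ ((integrable_fluxMass hV).const_mul _).intervalIntegrable
  have h1 : ∀ᵐ r, r ∈ Ioo 0 T → Integrable (V r) :=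
    (ae_restrict_iff' measurableSet_Ioo).1 hV.prod_right_ae
  have h2 : ∀ᵐ r : ℝ, r ≠ T := by simp [ae_iff]
  rw [ae_restrict_iff' measurableSet_uIoc]
  filter_upwards [h1, h2] with r hr hrT hab
  have hr' : r ∈ Ioo 0 T := ⟨(le_min ha.1 hb.1).trans_lt hab.1,
    (hab.2.trans (max_le ha.2 hb.2)).lt_of_ne hrT⟩
  rw [fluxMass, indicator_of_mem hr', ← integral_const_mul]
  refine norm_integral_le_of_norm_le ((hr hr').norm.const_mul _) (.of_forall fun x =>
    (norm_inner_le_norm _ _).trans ?_)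
  exact mul_le_mul_of_nonneg_right (norm_gradient_le_of_lipschitz hζ x) (norm_nonneg _)

variable {I : Set ℝ} {m₁ m₂ : ℝ → Rd d → ℝ} {V : ℝ → Rd d → Rd d}

lemma EvolvesBy.integral_sub_integral (h : EvolvesBy T I m₁ m₂ V) {s t : ℝ} (hs : s ∈ I)
    (ht : t ∈ I) {ζ : Rd d → ℝ} {K : ℝ≥0} (hζ : LipschitzWith K ζ) {C : ℝ} (hC : ∀ x, |ζ x| ≤ C) :
    (∫ x, ζ x * (m₁ t x - m₂ t x)) - ∫ x, ζ x * (m₁ s x - m₂ s x)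
      = ∫ x, inner ℝ (gradient ζ x) (fluxBetween V s t x) := by
  have i1 : Integrable fun x => m₁ t x - m₂ t x := (h.left t ht).sub (h.right t ht)
  have i2 : Integrable fun x => m₁ s x - m₂ s x := (h.left s hs).sub (h.right s hs)
  have h1 := WeakDivAgainst.of_bounded_lipschitz (i1.sub i2)
    (integrable_fluxBetween h.flux (h.subset hs) (h.subset ht)) (h.weakDiv s hs t ht) hζ hC
  rw [← h1, ← integral_sub (integrable_mul_of_bounded i1 hζ.continuous hC)
    (integrable_mul_of_bounded i2 hζ.continuous hC)]
  refine integral_congr_ae (.of_forall fun x => ?_)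
  simp only [Pi.sub_apply]
  ring

/-- Each bounded admissible `ζ` obeys this estimate, with the same `L`; duality passes it to the
distance. Finiteness at `t` is a conclusion here, not an assumption. -/
lemma EvolvesBy.transportDist_le (h : EvolvesBy T I m₁ m₂ V) (hc : IsConcaveCost c) {L : ℝ≥0}
    (hL : ∀ z, 0 ≤ z → c z ≤ L * z) {s t : ℝ} (hs : s ∈ I) (ht : t ∈ I)
    (hfin : transportDist c (m₁ s) (m₂ s) < ⊤) :
    transportDist c (m₁ t) (m₂ t) ≤ ENNReal.ofReal
      ((transportDist c (m₁ s) (m₂ s)).toReal + |∫ r in s..t, L * fluxMass T V r|) := by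
  refine transportDist_le_of_dual_le hc (h.left t ht) (h.right t ht) fun ζ hζ ⟨C, hC⟩ => ?_
  have h1 := h.integral_sub_integral hs ht (hζ.lipschitzWith hL) hC
  have h2 := (le_abs_self _).trans (abs_integral_inner_fluxBetween_le h.flux (h.subset hs)
    (h.subset ht) (hζ.lipschitzWith hL))
  have h3 := integral_le_transportDist hc (h.left s hs) (h.right s hs) hfin hζ hC
  linarith

lemma EvolvesBy.transportDist_lt_top (h : EvolvesBy T I m₁ m₂ V) (hc : IsConcaveCost c)
    {s t : ℝ} (hs : s ∈ I) (ht : t ∈ I) (hfin : transportDist c (m₁ s) (m₂ s) < ⊤) :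
    transportDist c (m₁ t) (m₂ t) < ⊤ := by
  obtain ⟨L, hL⟩ := hc.exists_le_mul
  exact (h.transportDist_le hc hL hs ht hfin).trans_lt ENNReal.ofReal_lt_top

/-- The transport distance is the restriction of an absolutely continuous function. -/
theorem EvolvesBy.exists_absolutelyContinuous (h : EvolvesBy T I m₁ m₂ V) (hc : IsConcaveCost c)
    (hfin : ∀ t ∈ I, transportDist c (m₁ t) (m₂ t) < ⊤) :
    ∃ D : ℝ → ℝ, AbsolutelyContinuousOnInterval D 0 T ∧ Continuous D ∧
      ∀ t ∈ I, (transportDist c (m₁ t) (m₂ t)).toReal = D t := by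
  obtain ⟨L, hL⟩ := hc.exists_le_mul
  have hi : Integrable fun r => L * fluxMass T V r := (integrable_fluxMass h.flux).const_mul _
  let A : ℝ → ℝ := fun t => ∫ r in 0..t, L * fluxMass T V r
  have hsub : ∀ s t, A t - A s = ∫ r in s..t, L * fluxMass T V r := fun s t =>
    intervalIntegral.integral_interval_sub_left hi.intervalIntegrable hi.intervalIntegrable
  have hle : ∀ s ∈ I, ∀ t ∈ I, (transportDist c (m₁ t) (m₂ t)).toReal -
      (transportDist c (m₁ s) (m₂ s)).toReal ≤ |A t - A s| := fun s hs t ht => by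
    have h1 := h.transportDist_le hc hL hs ht (hfin s hs)
    rw [ENNReal.le_ofReal_iff_toReal_le (hfin t ht).ne
      (add_nonneg ENNReal.toReal_nonneg (abs_nonneg _)), ← hsub] at h1
    linarith
  obtain ⟨D, hD, hDA⟩ := exists_extension_of_increment_le (I := I) (A := A)
    (E := fun t => (transportDist c (m₁ t) (m₂ t)).toReal) fun s hs t ht =>
      abs_sub_le_iff.2 ⟨hle s hs t ht, by rw [abs_sub_comm]; exact hle t ht s hs⟩
  have hAac : AbsolutelyContinuousOnInterval A 0 T :=
    hi.intervalIntegrable.absolutelyContinuousOnInterval_intervalIntegral left_mem_uIcc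
  have hAc : Continuous A := intervalIntegral.continuous_primitive
    (fun _ _ => hi.intervalIntegrable) 0
  refine ⟨D, absolutelyContinuousOnInterval_of_increment_le hAac hDA, ?_, fun t ht => (hD t ht).symm⟩
  rw [continuous_iff_continuousAt]
  intro s
  rw [ContinuousAt, tendsto_iff_norm_sub_tendsto_zero]
  exact squeeze_zero (fun _ => norm_nonneg _) (fun t => hDA s t)
    (tendsto_iff_norm_sub_tendsto_zero.1 (hAc.tendsto s))

end Flow

/-! ### Differentiation in time -/

section Lebesgue

variable {d : ℕ} {T : ℝ} {V : ℝ → Rd d → Rd d}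

lemma integrable_indicator_norm_sub (hV : Integrable (Function.uncurry V) (spaceTime d T))
    {f : Rd d → Rd d} (hf : Integrable f) :
    Integrable ((Ioo 0 T).indicator fun r => ∫ x, ‖V r x - f x‖) := by
  rw [integrable_indicator_iff measurableSet_Ioo]
  have h1 : Integrable (fun z : ℝ × Rd d => f z.2) (spaceTime d T) := hf.comp_snd _
  exact (hV.sub h1).norm.integral_prod_left

/-- Almost every time is a Lebesgue point of the flux in `L¹`: the approximation by a countable
dense family. -/
lemma exists_dense_lebesgue_points (hV : Integrable (Function.uncurry V) (spaceTime d T)) :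
    ∃ f : ℕ → Rd d → Rd d, (∀ n, Integrable (f n)) ∧
      (∀ g : Rd d → Rd d, Integrable g → ∀ ε > 0, ∃ n, ∫ x, ‖g x - f n x‖ < ε) ∧
      ∀ᵐ t, ∀ n, HasDerivAt
        (fun s => ∫ r in t..s, (Ioo 0 T).indicator (fun r => ∫ x, ‖V r x - f n x‖) r)
        ((Ioo 0 T).indicator (fun r => ∫ x, ‖V r x - f n x‖) t) t := by
  have : Fact ((1 : ℝ≥0∞) ≠ ⊤) := ⟨ENNReal.one_ne_top⟩
  let e : ℕ → Lp (Rd d) 1 (volume : Measure (Rd d)) := TopologicalSpace.denseSeq _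
  have hi : ∀ n, Integrable (e n) := fun n => L1.integrable_coeFn _
  refine ⟨fun n => e n, hi, fun g hg ε hε => ?_, ?_⟩
  · obtain ⟨n, hn⟩ := (TopologicalSpace.denseRange_denseSeq
      (Lp (Rd d) 1 (volume : Measure (Rd d)))).exists_dist_lt (hg.toL1 g) hε
    refine ⟨n, ?_⟩
    rw [dist_eq_norm, L1.norm_eq_integral_norm] at hn
    refine lt_of_eq_of_lt (integral_congr_ae ?_) hn
    filter_upwards [hg.coeFn_toL1, Lp.coeFn_sub (hg.toL1 g) (e n)] with x h1 h2
    rw [h2, Pi.sub_apply, h1]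
  · rw [ae_all_iff]
    intro n
    filter_upwards [LocallyIntegrable.ae_hasDerivAt_integral
      (integrable_indicator_norm_sub hV (hi n)).locallyIntegrable] with t ht using ht t

/-- At almost every time, the primitive of the flux is differentiable against all Lipschitz
functions. -/
lemma ae_hasDerivAt_integral_inner (hV : Integrable (Function.uncurry V) (spaceTime d T)) :
    ∀ᵐ t ∂(volume.restrict (Ioo 0 T)), ∀ (ζ : Rd d → ℝ) (K : ℝ≥0), LipschitzWith K ζ →
      HasDerivAt (fun s => ∫ r in t..s, ∫ x, inner ℝ (gradient ζ x) (V r x))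
        (∫ x, inner ℝ (gradient ζ x) (V t x)) t := by
  obtain ⟨f, hfi, hfd, hfae⟩ := exists_dense_lebesgue_points hV
  have hVt : ∀ᵐ r, r ∈ Ioo 0 T → Integrable (V r) :=
    (ae_restrict_iff' measurableSet_Ioo).1 hV.prod_right_ae
  rw [ae_restrict_iff' measurableSet_Ioo]
  filter_upwards [hfae, hVt] with t ht hVt' hmem ζ K hζ
  have hint := hVt' hmem
  have hT : 0 < T := hmem.1.trans hmem.2
  let q : ℝ → ℝ := fun r => ∫ x, inner ℝ (gradient ζ x) (V r x)
  rw [hasDerivAt_iff_isLittleO, Asymptotics.isLittleO_iff]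
  intro ε hε
  have hK : (0 : ℝ) < K + 1 := by positivity
  -- The function `f n` stands in for `V t`. One third of `ε` pays for the derivative error of the
  -- primitive of `N`, two thirds for `2 * N t`; `K + 1` avoids dividing by `0`.
  obtain ⟨n, hn⟩ := hfd _ hint (ε / (3 * (K + 1))) (by positivity)
  let N : ℝ → ℝ := (Ioo 0 T).indicator fun r => ∫ x, ‖V r x - f n x‖
  have hN0 : ∀ r, 0 ≤ N r := fun r =>
    indicator_nonneg (fun _ _ => integral_nonneg fun _ => norm_nonneg _) _
  have hNt : N t < ε / (3 * (K + 1)) := by simpa only [N, indicator_of_mem hmem] using hn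
  have hNi : Integrable N := integrable_indicator_norm_sub hV (hfi n)
  have h1 := ht n
  rw [hasDerivAt_iff_isLittleO, Asymptotics.isLittleO_iff] at h1
  filter_upwards [h1 (by positivity : 0 < ε / (3 * (K + 1))), Ioo_mem_nhds hmem.1 hmem.2]
    with s hs hsmem
  simp only [intervalIntegral.integral_same, sub_zero, smul_eq_mul, Real.norm_eq_abs] at hs ⊢
  change |(∫ r in t..s, N r) - (s - t) * N t| ≤ _ at hs
  change |(∫ r in t..s, q r) - (s - t) * q t| ≤ _
  have hq := intervalIntegrable_inner_gradient hV (Ioo_subset_Icc_self hmem)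
    (Ioo_subset_Icc_self hsmem) hζ
  have h2 : (∫ r in t..s, q r) - (s - t) * q t = ∫ r in t..s, (q r - q t) := by
    rw [intervalIntegral.integral_sub hq (by simp), intervalIntegral.integral_const, smul_eq_mul]
  have h3 : |∫ r in t..s, (q r - q t)| ≤ |∫ r in t..s, K * (N r + N t)| := by
    refine intervalIntegral.norm_integral_le_abs_of_norm_le (f := fun r => q r - q t) ?_
      (((hNi.intervalIntegrable).add (by simp)).const_mul _)
    rw [ae_restrict_iff' measurableSet_uIoc]
    filter_upwards [hVt] with r hr hrmem
    have hr' : r ∈ Ioo 0 T := ⟨(lt_min hmem.1 hsmem.1).trans hrmem.1,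
      hrmem.2.trans_lt (max_lt hmem.2 hsmem.2)⟩
    have hri := hr hr'
    have h4 : q r - q t = ∫ x, inner ℝ (gradient ζ x) (V r x - V t x) := by
      simp_rw [inner_sub_right]
      exact (integral_sub (integrable_inner_gradient hri hζ) (integrable_inner_gradient hint hζ)).symm
    simp only [h4]
    have h5 : N r + N t = ∫ x, (‖V r x - f n x‖ + ‖V t x - f n x‖) := by
      simp only [N, indicator_of_mem hr', indicator_of_mem hmem]
      exact (integral_add (hri.sub (hfi n)).norm (hint.sub (hfi n)).norm).symm
    rw [h5, ← integral_const_mul]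
    refine norm_integral_le_of_norm_le
      (((hri.sub (hfi n)).norm.add (hint.sub (hfi n)).norm).const_mul _)
      (.of_forall fun x => (norm_inner_le_norm _ _).trans ?_)
    refine mul_le_mul (norm_gradient_le_of_lipschitz hζ x) ?_ (norm_nonneg _) K.coe_nonneg
    rw [← dist_eq_norm, ← dist_eq_norm, ← dist_eq_norm]
    exact dist_triangle_right _ _ _
  have h6 : ∫ r in t..s, K * (N r + N t) = K * ((∫ r in t..s, N r) + (s - t) * N t) := by
    rw [intervalIntegral.integral_const_mul, intervalIntegral.integral_add hNi.intervalIntegrable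
      (by simp), intervalIntegral.integral_const, smul_eq_mul]
  rw [h2]
  refine h3.trans ?_
  rw [h6, abs_mul, abs_of_nonneg K.coe_nonneg]
  have h7 : |(∫ r in t..s, N r) + (s - t) * N t| ≤ 3 * (ε / (3 * (K + 1))) * |s - t| := by
    have h8 : (∫ r in t..s, N r) + (s - t) * N t
      = ((∫ r in t..s, N r) - (s - t) * N t) + 2 * ((s - t) * N t) := by ring
    rw [h8]
    refine (abs_add_le _ _).trans ?_
    rw [abs_mul, abs_mul, abs_of_nonneg (hN0 t), abs_two]
    have h9 := mul_le_mul_of_nonneg_left hNt.le (abs_nonneg (s - t))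
    linarith
  calc K * |(∫ r in t..s, N r) + (s - t) * N t|
      ≤ (K + 1) * (3 * (ε / (3 * (K + 1))) * |s - t|) :=
        mul_le_mul (by linarith) h7 (abs_nonneg _) hK.le
    _ = ε * |s - t| := by field_simp

end Lebesgue

/-! ### The envelope argument -/

section Derivative

variable {d : ℕ} {T : ℝ} {c : ℝ → ℝ} {I : Set ℝ} {m₁ m₂ : ℝ → Rd d → ℝ} {V : ℝ → Rd d → Rd d}

/-- Once `N > |ζ x|`, truncation is inactive in a neighbourhood of `x`, so the gradients there
coincide. -/
lemma tendsto_integral_inner_gradient_clampFun {Φ : Rd d → Rd d} (hΦ : Integrable Φ)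
    {ζ : Rd d → ℝ} {L : ℝ≥0} (hζ : LipschitzWith L ζ) :
    Tendsto (fun N : ℕ => ∫ x, inner ℝ (gradient (clampFun N ζ) x) (Φ x)) atTop
      (𝓝 (∫ x, inner ℝ (gradient ζ x) (Φ x))) := by
  have hlip : ∀ N : ℕ, LipschitzWith L (clampFun N ζ) := fun N =>
    LipschitzWith.of_dist_le_mul fun x y =>
      (abs_clampFun_sub_le N ζ x y).trans (hζ.dist_le_mul x y)
  refine tendsto_integral_of_dominated_convergence (fun x => L * ‖Φ x‖)
    (fun N => (integrable_inner_gradient hΦ (hlip N)).aestronglyMeasurable)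
    (hΦ.norm.const_mul L) (fun N => .of_forall fun x => (norm_inner_le_norm _ _).trans ?_)
    (.of_forall fun x => ?_)
  · exact mul_le_mul_of_nonneg_right (norm_gradient_le_of_lipschitz (hlip N) x) (norm_nonneg _)
  · obtain ⟨N, hN⟩ := exists_nat_gt |ζ x|
    refine tendsto_const_nhds.congr' ?_
    filter_upwards [eventually_ge_atTop N] with j hj
    have h1 : ∀ᶠ y in 𝓝 x, |ζ y| < N := (hζ.continuous.abs.tendsto x).eventually_lt_const hN
    rw [gradient_congr_of_eventuallyEq (ζ := clampFun j ζ) (ξ := ζ)]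
    filter_upwards [h1] with y hy
    exact clampFun_eq (hy.le.trans (by exact_mod_cast hj))

/-- A Kantorovich potential at time `t` bounds the increments of the transport distance. -/
lemma EvolvesBy.le_increment (h : EvolvesBy T I m₁ m₂ V) (hc : IsConcaveCost c)
    (hfin : ∀ t ∈ I, transportDist c (m₁ t) (m₂ t) < ⊤) {s t : ℝ} (hs : s ∈ I) (ht : t ∈ I)
    {ζ : Rd d → ℝ} (hζ : IsKantorovichPotential c (m₁ t) (m₂ t) ζ) :
    ∫ r in t..s, ∫ x, inner ℝ (gradient ζ x) (V r x) ≤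
      (transportDist c (m₁ s) (m₂ s)).toReal - (transportDist c (m₁ t) (m₂ t)).toReal := by
  obtain ⟨L, hL⟩ := hc.exists_le_mul
  have hadm : IsAdmissible (fun x y => c (dist x y)) ζ := hζ.1
  have hlip := hadm.lipschitzWith hL
  -- The potential may be unbounded, so its pairings are limits of truncations: at `s` the limit is
  -- at most the distance, at `t` it equals the distance.
  obtain ⟨l, hl, hls⟩ := exists_tendsto_clampFun_le hc (h.left s hs) (h.right s hs) (hfin s hs) hadm
  have h1 := hζ.tendsto_clampFun hc (h.left t ht) (h.right t ht) (hfin t ht)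
  have h2 := (hls.sub h1).congr fun N => h.integral_sub_integral ht hs
    ((hadm.clampFun N).lipschitzWith hL) (abs_clampFun_le N ζ)
  have h3 := tendsto_integral_inner_gradient_clampFun
    (integrable_fluxBetween h.flux (h.subset ht) (h.subset hs)) hlip
  rw [← integral_inner_fluxBetween h.flux (h.subset ht) (h.subset hs) hlip,
    tendsto_nhds_unique h3 h2]
  linarith

/-- The derivative of the transport distance along a flux. -/
theorem EvolvesBy.hasDerivAt (h : EvolvesBy T I m₁ m₂ V) (hc : IsConcaveCost c)
    (hI : ∀ᵐ t ∂(volume.restrict (Ioo 0 T)), t ∈ I)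
    (hfin : ∀ t ∈ I, transportDist c (m₁ t) (m₂ t) < ⊤) {D : ℝ → ℝ} (hDc : Continuous D)
    (hD : ∀ t ∈ I, (transportDist c (m₁ t) (m₂ t)).toReal = D t) {t : ℝ} (ht : t ∈ I)
    (htT : t ∈ Ioo 0 T) (hdiff : DifferentiableAt ℝ D t) {ζ : Rd d → ℝ}
    (hζ : IsKantorovichPotential c (m₁ t) (m₂ t) ζ)
    (hLeb : ∀ (ζ : Rd d → ℝ) (K : ℝ≥0), LipschitzWith K ζ →
      HasDerivAt (fun s => ∫ r in t..s, ∫ x, inner ℝ (gradient ζ x) (V r x))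
        (∫ x, inner ℝ (gradient ζ x) (V t x)) t) :
    HasDerivAt D (∫ x, inner ℝ (gradient ζ x) (V t x)) t := by
  obtain ⟨L, hL⟩ := hc.exists_le_mul
  have hadm : IsAdmissible (fun x y => c (dist x y)) ζ := hζ.1
  have hlip := hadm.lipschitzWith hL
  let Q : ℝ → ℝ := fun s => ∫ r in t..s, ∫ x, inner ℝ (gradient ζ x) (V r x)
  have hQd : HasDerivAt Q (∫ x, inner ℝ (gradient ζ x) (V t x)) t := hLeb ζ L hlip
  have hT : 0 ≤ T := (htT.1.trans htT.2).le
  have hQc : ContinuousOn Q (Ioo 0 T) := by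
    have h1 := intervalIntegral.continuousOn_primitive_interval' (intervalIntegrable_inner_gradient
      h.flux ⟨le_rfl, hT⟩ ⟨hT, le_rfl⟩ hlip) (by rw [uIcc_of_le hT]; exact h.subset ht)
    exact h1.mono (by rw [uIcc_of_le hT]; exact Ioo_subset_Icc_self)
  have hdense : Dense {s | s ∈ Ioo 0 T → s ∈ I} :=
    Measure.dense_of_ae ((ae_restrict_iff' measurableSet_Ioo).1 hI)
  -- The inequality is known for `s ∈ I`; since almost every time is in `I`, density and continuity
  -- of `D` and `Q` extend it to all of `(0, T)`.
  have hle : ∀ s ∈ Ioo 0 T, D t - Q t ≤ D s - Q s := fun s hs => by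
    by_contra! hcon
    have h1 : ContinuousAt (fun s => D s - Q s) s :=
      hDc.continuousAt.sub (hQc.continuousAt (Ioo_mem_nhds hs.1 hs.2))
    have h2 : ∀ᶠ s' in 𝓝 s, D s' - Q s' < D t - Q t := h1.eventually_lt_const hcon
    have h3 := h2.and (Ioo_mem_nhds hs.1 hs.2)
    obtain ⟨s', h4, hmem⟩ := hdense.exists_mem_open isOpen_interior
      ⟨s, mem_interior_iff_mem_nhds.2 h3⟩
    obtain ⟨h5, h6⟩ := interior_subset hmem
    have h7 := h.le_increment hc hfin (h4 h6) ht hζ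
    rw [hD _ (h4 h6), hD t ht] at h7
    change Q s' ≤ _ at h7
    have h8 : Q t = 0 := intervalIntegral.integral_same
    linarith
  -- A one-signed inequality suffices, because `s` ranges on both sides of `t` and `D` is already
  -- known to be differentiable there.
  have hmin : IsLocalMin (fun s => D s - Q s) t := by
    filter_upwards [Ioo_mem_nhds htT.1 htT.2] with s hs using hle s hs
  have h0 := hmin.hasDerivAt_eq_zero (hdiff.hasDerivAt.sub hQd)
  rw [← sub_eq_zero.1 h0]
  exact hdiff.hasDerivAt

end Derivative

/-! ### From the two equations to the joint evolution -/

section Assembly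

variable {d : ℕ} {T : ℝ}

lemma WeakDivAgainst.sub {α₁ α₂ : Rd d → ℝ} {Φ₁ Φ₂ : Rd d → Rd d} {ζ : Rd d → ℝ} {K : ℝ≥0}
    (h₁ : WeakDivAgainst α₁ Φ₁ ζ) (h₂ : WeakDivAgainst α₂ Φ₂ ζ)
    (hα₁ : Integrable fun x => ζ x * α₁ x) (hα₂ : Integrable fun x => ζ x * α₂ x)
    (hΦ₁ : Integrable Φ₁) (hΦ₂ : Integrable Φ₂) (hζ : LipschitzWith K ζ) {α : Rd d → ℝ}
    {Φ : Rd d → Rd d} (hα : ∀ x, α x = α₁ x - α₂ x) (hΦ : ∀ᵐ x, Φ x = Φ₁ x - Φ₂ x) :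
    WeakDivAgainst α Φ ζ := by
  have e1 : ∫ x, ζ x * α x = (∫ x, ζ x * α₁ x) - ∫ x, ζ x * α₂ x := by
    rw [← integral_sub hα₁ hα₂]
    exact integral_congr_ae (.of_forall fun x => by simp only [hα]; ring)
  have e2 : ∫ x, inner ℝ (gradient ζ x) (Φ x)
      = (∫ x, inner ℝ (gradient ζ x) (Φ₁ x)) - ∫ x, inner ℝ (gradient ζ x) (Φ₂ x) := by
    rw [← integral_sub (integrable_inner_gradient hΦ₁ hζ) (integrable_inner_gradient hΦ₂ hζ)]
    refine integral_congr_ae ?_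
    filter_upwards [hΦ] with x hx
    rw [hx, inner_sub_right]
  rw [WeakDivAgainst, e1, e2, h₁, h₂]

lemma ae_intervalIntegrable_of_spaceTime {V : ℝ → Rd d → Rd d}
    (hV : Integrable (Function.uncurry V) (spaceTime d T)) :
    ∀ᵐ x, ∀ a ∈ Icc 0 T, ∀ b ∈ Icc 0 T, IntervalIntegrable (fun r => V r x) volume a b := by
  filter_upwards [hV.prod_left_ae] with x hx a ha b hb
  have h1 : IntegrableOn (fun r => V r x) (Ioo 0 T) := hx
  rw [intervalIntegrable_iff']
  exact ((integrableOn_Icc_iff_integrableOn_Ioo (by simp) (by simp)).2 h1).mono_set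
    (uIcc_subset_Icc ha hb)

/-- If the difference to some locally integrable function is the divergence of the flux accumulated
from time `0`, then the densities evolve by the flux. -/
lemma EvolvesBy.of_initial (hT : 0 < T) {I : Set ℝ} {m₁ m₂ : ℝ → Rd d → ℝ} {V : ℝ → Rd d → Rd d}
    {η₀ : Rd d → ℝ} (hη₀ : LocallyIntegrable η₀) (hI : I ⊆ Icc 0 T)
    (h₁ : ∀ t ∈ I, Integrable (m₁ t)) (h₂ : ∀ t ∈ I, Integrable (m₂ t))
    (hV : Integrable (Function.uncurry V) (spaceTime d T))
    (hdiv : ∀ t ∈ I, ∀ ζ : Rd d → ℝ, ContDiff ℝ ∞ ζ → HasCompactSupport ζ →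
      WeakDivAgainst (fun x => (m₁ t x - m₂ t x) - η₀ x) (fluxBetween V 0 t) ζ) :
    EvolvesBy T I m₁ m₂ V := by
  refine ⟨hI, h₁, h₂, hV, fun s hs t ht ζ hζ hc => ?_⟩
  obtain ⟨K, hK⟩ := ContDiff.lipschitzWith_of_hasCompactSupport hc hζ (by simp)
  have h0 : (0 : ℝ) ∈ Icc 0 T := ⟨le_rfl, hT.le⟩
  have hi : ∀ t ∈ I, Integrable fun x => ζ x * ((m₁ t x - m₂ t x) - η₀ x) := fun t ht =>
    (((h₁ t ht).sub (h₂ t ht)).locallyIntegrable.sub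
      hη₀).integrable_smul_left_of_hasCompactSupport hζ.continuous hc
  -- The merely locally integrable `η₀` cancels between the times `s` and `t`, leaving integrable
  -- densities.
  refine (hdiv t ht ζ hζ hc).sub (hdiv s hs ζ hζ hc) (hi t ht) (hi s hs)
    (integrable_fluxBetween hV h0 (hI ht)) (integrable_fluxBetween hV h0 (hI hs)) hK
    (fun x => by ring) ?_
  filter_upwards [ae_intervalIntegrable_of_spaceTime hV] with x hx
  exact (intervalIntegral.integral_interval_sub_left (hx _ h0 _ (hI ht)) (hx _ h0 _ (hI hs))).symm

/-- The times at which both solutions are regular, with the initial time added if the initial data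
are integrable. -/
def regularTimes (T : ℝ) (μ₁₀ μ₂₀ : Rd d → ℝ) (μ₁ μ₂ : ℝ → Rd d → ℝ) (V : ℝ → Rd d → Rd d) :
    Set ℝ :=
  {t | t = 0 ∧ Integrable μ₁₀ ∧ Integrable μ₂₀} ∪
  {t | t ∈ Ioo 0 T ∧ Integrable (μ₁ t) ∧ Integrable (μ₂ t) ∧
    ∀ ζ : Rd d → ℝ, ContDiff ℝ ∞ ζ → HasCompactSupport ζ →
      WeakDivAgainst (fun x => (μ₁ t x - μ₂ t x) - (μ₁₀ x - μ₂₀ x)) (fluxBetween V 0 t) ζ}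

/-- Two solutions of advection-diffusion equations evolve by the difference of their fluxes. -/
lemma exists_evolvesBy (hT : 0 < T)
    {u₁ u₂ : ℝ → Rd d → Rd d} {κ₁ κ₂ : ℝ} {μ₁₀ μ₂₀ : Rd d → ℝ} {μ₁ μ₂ : ℝ → Rd d → ℝ}
    {Dμ₁ Dμ₂ : ℝ → Rd d → Rd d}
    (hsol₁ : IsDistributionalSolution T u₁ κ₁ μ₁₀ μ₁)
    (hsol₂ : IsDistributionalSolution T u₂ κ₂ μ₂₀ μ₂)
    (hW₁ : MemL1W11 T μ₁ Dμ₁) (hW₂ : MemL1W11 T μ₂ Dμ₂)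
    (hflux₁ : Integrable (fun z : ℝ × Rd d => μ₁ z.1 z.2 • u₁ z.1 z.2) (spaceTime d T))
    (hflux₂ : Integrable (fun z : ℝ × Rd d => μ₂ z.1 z.2 • u₂ z.1 z.2) (spaceTime d T)) :
    ∃ (I : Set ℝ) (m₁ m₂ : ℝ → Rd d → ℝ),
      EvolvesBy T I m₁ m₂ (fun s x => (μ₁ s x • u₁ s x - κ₁ • Dμ₁ s x) -
        (μ₂ s x • u₂ s x - κ₂ • Dμ₂ s x)) ∧
      (∀ᵐ t ∂(volume.restrict (Ioo 0 T)), t ∈ I) ∧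
      (∀ t ∈ Ioo 0 T, m₁ t = μ₁ t ∧ m₂ t = μ₂ t) ∧ m₁ 0 = μ₁₀ ∧ m₂ 0 = μ₂₀ ∧
      (Integrable μ₁₀ → Integrable μ₂₀ → (0 : ℝ) ∈ I) := by
  set V₁ : ℝ → Rd d → Rd d := fun s x => μ₁ s x • u₁ s x - κ₁ • Dμ₁ s x
  set V₂ : ℝ → Rd d → Rd d := fun s x => μ₂ s x • u₂ s x - κ₂ • Dμ₂ s x
  have hV₁ : Integrable (Function.uncurry V₁) (spaceTime d T) := hflux₁.sub (hW₁.2.1.smul κ₁)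
  have hV₂ : Integrable (Function.uncurry V₂) (spaceTime d T) := hflux₂.sub (hW₂.2.1.smul κ₂)
  have hμ₁₀ := hsol₁.locallyIntegrable_initial
  have hμ₂₀ := hsol₂.locallyIntegrable_initial
  have h0 : (0 : ℝ) ∈ Icc 0 T := ⟨le_rfl, hT.le⟩
  have hne : ∀ t ∈ Ioo 0 T, t ≠ 0 := fun t ht => ht.1.ne'
  -- The values of `μᵢ` at time `0` carry no information, so they are replaced by the initial data.
  -- Time `0` then becomes an ordinary time of the evolution, and `D 0` needs no separate argument.
  refine ⟨regularTimes T μ₁₀ μ₂₀ μ₁ μ₂ (fun s x => V₁ s x - V₂ s x), Function.update μ₁ 0 μ₁₀,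
    Function.update μ₂ 0 μ₂₀, EvolvesBy.of_initial hT (hμ₁₀.sub hμ₂₀) ?_ ?_ ?_ (hV₁.sub hV₂) ?_,
    ?_, fun t ht => ⟨Function.update_of_ne (hne t ht) _ _, Function.update_of_ne (hne t ht) _ _⟩,
    Function.update_self _ _ _, Function.update_self _ _ _, fun h1 h2 => Or.inl ⟨rfl, h1, h2⟩⟩
  · rintro t (⟨rfl, -⟩ | ⟨ht, -⟩)
    · exact h0
    · exact Ioo_subset_Icc_self ht
  · rintro t (⟨rfl, h, -⟩ | ⟨ht, h, -⟩)
    · rwa [Function.update_self]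
    · rwa [Function.update_of_ne (hne t ht)]
  · rintro t (⟨rfl, -, h⟩ | ⟨ht, -, h, -⟩)
    · rwa [Function.update_self]
    · rwa [Function.update_of_ne (hne t ht)]
  · rintro t (⟨rfl, -⟩ | ⟨ht, -, -, h⟩) ζ hζ hc
    · rw [Function.update_self, Function.update_self]
      simp [WeakDivAgainst, fluxBetween]
    · rw [Function.update_of_ne (hne t ht), Function.update_of_ne (hne t ht)]
      exact h ζ hζ hc
  · filter_upwards [ae_restrict_mem measurableSet_Ioo, hW₁.1.prod_right_ae, hW₂.1.prod_right_ae,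
      hsol₁.ae_weakDiv hT hW₁ hflux₁, hsol₂.ae_weakDiv hT hW₂ hflux₂] with t ht h1 h2 h3 h4
    refine Or.inr ⟨ht, h1, h2, fun ζ hζ hc => ?_⟩
    have h1' : Integrable (μ₁ t) := h1
    have h2' : Integrable (μ₂ t) := h2
    obtain ⟨K, hK⟩ := ContDiff.lipschitzWith_of_hasCompactSupport hc hζ (by simp)
    have htI := Ioo_subset_Icc_self ht
    refine (h3 ζ hζ hc).sub (h4 ζ hζ hc)
      ((h1'.locallyIntegrable.sub hμ₁₀).integrable_smul_left_of_hasCompactSupport hζ.continuous hc)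
      ((h2'.locallyIntegrable.sub hμ₂₀).integrable_smul_left_of_hasCompactSupport hζ.continuous hc)
      (integrable_fluxBetween hV₁ h0 htI) (integrable_fluxBetween hV₂ h0 htI) hK
      (fun x => by ring) ?_
    filter_upwards [ae_intervalIntegrable_of_spaceTime hV₁,
      ae_intervalIntegrable_of_spaceTime hV₂] with x hx₁ hx₂
    exact intervalIntegral.integral_sub (hx₁ _ h0 _ htI) (hx₂ _ h0 _ htI)

end Assembly

theorem mainTheorem6 {d : ℕ} {T : ℝ} (hT : 0 < T)
    (c : ℝ → ℝ) (hc : IsConcaveCost c)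
    (u₁ u₂ : ℝ → Rd d → Rd d) (κ₁ κ₂ : ℝ) (hκ₁ : 0 < κ₁) (hκ₂ : 0 < κ₂)
    (μ₁₀ μ₂₀ : Rd d → ℝ) (μ₁ μ₂ : ℝ → Rd d → ℝ) (Dμ₁ Dμ₂ : ℝ → Rd d → Rd d)
    -- distributional solutions, in `L¹(W^{1,1})`, with `Dμᵢ = ∇μᵢ`
    (hsol₁ : IsDistributionalSolution T u₁ κ₁ μ₁₀ μ₁)
    (hsol₂ : IsDistributionalSolution T u₂ κ₂ μ₂₀ μ₂)
    (hW₁ : MemL1W11 T μ₁ Dμ₁) (hW₂ : MemL1W11 T μ₂ Dμ₂)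
    -- the advective fluxes are in `L¹(L¹)`
    (hflux₁ : Integrable (fun z : ℝ × Rd d => μ₁ z.1 z.2 • u₁ z.1 z.2) (spaceTime d T))
    (hflux₂ : Integrable (fun z : ℝ × Rd d => μ₂ z.1 z.2 • u₂ z.1 z.2) (spaceTime d T))
    -- the distance is defined and finite, either initially or for a non-null set of times
    (hfin : (Integrable μ₁₀ ∧ Integrable μ₂₀ ∧ transportDist c μ₁₀ μ₂₀ < ⊤) ∨
      ∃ᵐ t ∂(volume.restrict (Ioo 0 T)), transportDist c (μ₁ t) (μ₂ t) < ⊤) :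
    ∃ D : ℝ → ℝ,
      AbsolutelyContinuousOnInterval D 0 T ∧
      (∀ᵐ t ∂(volume.restrict (Ioo 0 T)),
        transportDist c (μ₁ t) (μ₂ t) ≠ ⊤ ∧ (transportDist c (μ₁ t) (μ₂ t)).toReal = D t) ∧
      (Integrable μ₁₀ → Integrable μ₂₀ →
        transportDist c μ₁₀ μ₂₀ ≠ ⊤ ∧ (transportDist c μ₁₀ μ₂₀).toReal = D 0) ∧
      ∀ᵐ t ∂(volume.restrict (Ioo 0 T)),
        (∃ ζ, IsKantorovichPotential c (μ₁ t) (μ₂ t) ζ) ∧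
        ∀ ζ, IsKantorovichPotential c (μ₁ t) (μ₂ t) ζ →
          Integrable (fun x => inner ℝ (gradient ζ x) (μ₁ t x • u₁ t x - μ₂ t x • u₂ t x)) ∧
          Integrable (fun x => inner ℝ (gradient ζ x) (κ₁ • Dμ₁ t x - κ₂ • Dμ₂ t x)) ∧
          HasDerivAt D
            ((∫ x, inner ℝ (gradient ζ x) (μ₁ t x • u₁ t x - μ₂ t x • u₂ t x))
              - ∫ x, inner ℝ (gradient ζ x) (κ₁ • Dμ₁ t x - κ₂ • Dμ₂ t x)) t := by
  obtain ⟨I, m₁, m₂, hev, hI, hm, hm₁, hm₂, h0I⟩ :=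
    exists_evolvesBy hT hsol₁ hsol₂ hW₁ hW₂ hflux₁ hflux₂
  -- One regular time of finite distance is enough: either time `0`, or a point where the non-null
  -- set of finite times meets the conull set `I`.
  obtain ⟨s, hs, hsfin⟩ : ∃ s ∈ I, transportDist c (m₁ s) (m₂ s) < ⊤ := by
    rcases hfin with ⟨h1, h2, h3⟩ | h
    · exact ⟨0, h0I h1 h2, by rwa [hm₁, hm₂]⟩
    · obtain ⟨t, h1, h2, h3⟩ :=
        (h.and_eventually (hI.and (ae_restrict_mem measurableSet_Ioo))).exists
      exact ⟨t, h2, by rwa [(hm t h3).1, (hm t h3).2]⟩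
  have hfinI : ∀ t ∈ I, transportDist c (m₁ t) (m₂ t) < ⊤ := fun t ht =>
    hev.transportDist_lt_top hc hs ht hsfin
  obtain ⟨D, hDac, hDc, hD⟩ := hev.exists_absolutelyContinuous hc hfinI
  refine ⟨D, hDac, ?_, fun h1 h2 => ?_, ?_⟩
  · filter_upwards [hI, ae_restrict_mem measurableSet_Ioo] with t ht htT
    rw [← (hm t htT).1, ← (hm t htT).2]
    exact ⟨(hfinI t ht).ne, hD t ht⟩
  · rw [← hm₁, ← hm₂]
    exact ⟨(hfinI 0 (h0I h1 h2)).ne, hD 0 (h0I h1 h2)⟩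
  · have hdiff : ∀ᵐ t ∂(volume.restrict (Ioo 0 T)), DifferentiableAt ℝ D t := by
      rw [ae_restrict_iff' measurableSet_Ioo]
      filter_upwards [hDac.ae_differentiableAt] with t ht htT
      exact ht (by rw [uIcc_of_le hT.le]; exact Ioo_subset_Icc_self htT)
    filter_upwards [hI, ae_restrict_mem measurableSet_Ioo, hdiff,
      ae_hasDerivAt_integral_inner hev.flux, hflux₁.prod_right_ae, hflux₂.prod_right_ae,
      hW₁.2.1.prod_right_ae, hW₂.2.1.prod_right_ae] with t ht htT htd htL hf₁ hf₂ hg₁ hg₂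
    have hDt := hfinI t ht
    have hl := hev.left t ht
    have hr := hev.right t ht
    rw [(hm t htT).1] at hDt hl
    rw [(hm t htT).2] at hDt hr
    refine ⟨exists_isKantorovichPotential hc hl hr hDt, fun ζ hζ => ?_⟩
    obtain ⟨L, hL⟩ := hc.exists_le_mul
    have hlip : LipschitzWith L ζ := IsAdmissible.lipschitzWith hL hζ.1
    have i1 : Integrable fun x => inner ℝ (gradient ζ x) (μ₁ t x • u₁ t x - μ₂ t x • u₂ t x) :=
      integrable_inner_gradient (hf₁.sub hf₂) hlip
    have i2 : Integrable fun x => inner ℝ (gradient ζ x) (κ₁ • Dμ₁ t x - κ₂ • Dμ₂ t x) :=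
      integrable_inner_gradient ((hg₁.smul κ₁).sub (hg₂.smul κ₂)) hlip
    refine ⟨i1, i2, ?_⟩
    have h1 := hev.hasDerivAt hc hI hfinI hDc hD ht htT htd (ζ := ζ)
      (by rw [(hm t htT).1, (hm t htT).2]; exact hζ) htL
    convert h1 using 1
    rw [← integral_sub i1 i2]
    refine integral_congr_ae (.of_forall fun x => ?_)
    simp only [← inner_sub_right]
    congr 1
    abel
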